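/- Setting. An energy storage has capacity $\bar s>0$. Energy shocks arrive at the jump times $t_1<t_2<\dots$ of a Poisson process of rate $Q>0$; their sizes $W_1,W_2,\dots$ are i.i.d., independent of the arrival times, distributed as a random variable $W$ with values in $[0,B]$. While not full, the storage is refilled at rate $r>0$. A policy $\mu\in\Pi$ is a measurable map $\mu:[0,\bar s]\times[0,B]\to\mathbb R$ with $0\le\mu(s,w)\le\min\{s,w\}$; a shock of size $w$ at level $s$ lowers the level to $s-\mu(s,w)$, so that $s_t=s_0+\int_0^t r\,\mathbb 1_{\{s_\tau<\bar s\}}\,d\tau-\sum_{k:\,t_k\le t}\mu(s_{t_k^-},W_k)$. The stage cost $g:[0,B]\to\mathbb R$ is strictly increasing and continuously differentiable with $g(0)=0$ and $\mathbf E[g(W)]>0$ (hence bounded), and $\theta>0$ is a discount rate. For $s\in[0,\bar s]$ let $$C_\mu(s)=\mathbf E\Big[\sum_{k\ge1}e^{-\theta t_k}\,g\big(W_k-\mu(s_{t_k^-},W_k)\big)\,\Big|\,s_0=s\Big],\qquad C(s)=\min_{\mu\in\Pi}C_\mu(s),$$ and $J_\mu(s,w)=g(w-\mu(s,w))+C_\mu(s-\mu(s,w))$.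 A policy is optimal if it attains $C(s)$ for every $s\in[0,\bar s]$. Theorem. The costs $C_\mu(s)$ are well defined (the series converges almost surely and its sum is integrable), and some policy attains the minimum $C(s)$ for all $s\in[0,\bar s]$ simultaneously. Moreover: (i) $C$ is strictly decreasing on $[0,\bar s]$. (ii) If $g$ is convex, then $C$ is convex on $[0,\bar s]$. (iii) If $C$ is continuously differentiable on $[0,\bar s]$ (one-sided derivatives at the end points), then for all $s\in[0,\bar s]$ $$C'(s)=\frac{Q+\theta}{r}\,C(s)-\frac Qr\,\mathbf E\Big[\min_{u\in[0,\min\{s,W\}]}\{g(W-u)+C(s-u)\}\Big],\qquad C'(\bar s)=0 .$$ Optimal policies achieve this minimum: there is an optimal policy $\mu^*$ such that $u=\mu^*(s,w)$ minimizes $g(w-u)+C(s-u)$ over $u\in[0,\min\{s,w\}]$ for all $(s,w)\in[0,\bar s]\times[0,B]$; every optimal policy does so for Lebesgue-almost every $s\in[0,\bar s]$, and for $s=\bar s$, for almost every value $w$ of $W$; and every policy $\mu$ with $J_\mu(s,w)=\min_{\mu'\in\Pi}J_{\mu'}(s,w)$ at a point $(s,w)$ does so at that point. Furthermore, let $\mu\in\Pi$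 be a policy whose cost $C_\mu$ is differentiable on $[0,\bar s]$. Then the delay differential equation $$C_\mu'(s)=\frac{Q+\theta}{r}\,C_\mu(s)-\frac Qr\,\mathbf E\big[g(W-\mu(s,W))+C_\mu(s-\mu(s,W))\big]$$ holds for Lebesgue-almost every $s\in[0,\bar s]$, and at every $s\in[0,\bar s]$ at which the expectation on its right-hand side is continuous as a function of $s\in[0,\bar s]$; this is the case wherever $x\mapsto\mu(x,w)$ is continuous at $s$ for almost every value $w$ of $W$. If that expectation is continuous at $\bar s$, then $C_\mu'(\bar s)=0$. All the expectations above are of integrable random variables. -/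

import Mathlib

open MeasureTheory ProbabilityTheory Set

/-- Data and standing assumptions of the storage model. Energy shocks arrive according to a Poisson
process of rate `Q`; their sizes are i.i.d. with law `ν`, supported in `[0, B]`. The storage has
capacity `sbar` and is refilled at rate `r` while it is not full. `θ` is the discount rate and `g`
the stage cost as a function of the blackout size; only the values of `g` on `[0, B]` matter. -/
structure StorageModel where
  /-- refill rate (upward ramp constraint) of the storage -/
  r : ℝ
  /-- storage capacity -/
  sbar : ℝ
  /-- arrival rate of the shocks -/
  Q : ℝ
  /-- discount rate -/
  θ : ℝ
  /-- upper bound of the shock size -/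
  B : ℝ
  /-- law of the shock size `W` -/
  ν : Measure ℝ
  /-- stage cost -/
  g : ℝ → ℝ
  r_pos : 0 < r
  sbar_pos : 0 < sbar
  Q_pos : 0 < Q
  θ_pos : 0 < θ
  isProb : IsProbabilityMeasure ν
  support : ∀ᵐ w ∂ν, w ∈ Icc 0 B
  g_strictMono : StrictMonoOn g (Icc 0 B)
  g_contDiff : ContDiffOn ℝ 1 g (Icc 0 B)
  g_zero : g 0 = 0
  g_mean_pos : 0 < ∫ w, g w ∂ν

namespace StorageModel

noncomputable section

/-- Level of the storage after it has been refilled during a time `h`, without any shock, starting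
from the level `x`. -/
def refill (M : StorageModel) (x h : ℝ) : ℝ := min (x + M.r * h) M.sbar

/-- `refill` solves the shock-free storage dynamics `s_h = x + ∫₀ʰ 1{s_τ < sbar} r dτ`. -/
theorem refill_eq_integral (M : StorageModel) {x h : ℝ} (hx : x ≤ M.sbar) (hh : 0 ≤ h) :
    M.refill x h = x + ∫ τ in (0 : ℝ)..h, (if M.refill x τ < M.sbar then M.r else 0) := by
  have hr := M.r_pos
  have h0 : 0 ≤ (M.sbar - x) / M.r := div_nonneg (by linarith) hr.le
  have e : (fun τ => if M.refill x τ < M.sbar then M.r else 0) =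
      (Iio ((M.sbar - x) / M.r)).indicator fun _ => M.r := by
    funext τ
    have : M.refill x τ < M.sbar ↔ τ ∈ Iio ((M.sbar - x) / M.r) := by
      rw [mem_Iio, lt_div_iff₀ hr, refill, min_lt_iff]
      constructor
      · rintro (h | h) <;> nlinarith
      · intro h; left; nlinarith
    simp only [this, indicator]
  rw [e, intervalIntegral.integral_of_le hh, setIntegral_indicator measurableSet_Iio,
    setIntegral_const, refill]
  rcases lt_or_ge h ((M.sbar - x) / M.r) with hc | hc
  · have : Ioc 0 h ∩ Iio ((M.sbar - x) / M.r) = Ioc 0 h := by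
      ext y; simp only [mem_inter_iff, mem_Ioc, mem_Iio]; constructor
      · exact fun h => h.1
      · exact fun h => ⟨h, by linarith⟩
    rw [this, Real.volume_real_Ioc_of_le hh, smul_eq_mul]
    rw [lt_div_iff₀ hr] at hc
    rw [min_eq_left (by nlinarith)]; ring
  · have : Ioc 0 h ∩ Iio ((M.sbar - x) / M.r) = Ioo 0 ((M.sbar - x) / M.r) := by
      ext y; simp only [mem_inter_iff, mem_Ioc, mem_Iio, mem_Ioo]; constructor
      · exact fun h => ⟨h.1.1, h.2⟩
      · exact fun h => ⟨⟨h.1, by linarith⟩, h.2⟩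
    rw [this, Real.volume_real_Ioo_of_le h0, smul_eq_mul]
    have hb := (div_le_iff₀ hr).1 hc
    rw [min_eq_right (by nlinarith), sub_zero, div_mul_cancel₀ _ hr.ne']; ring

/-- Law of the marked arrivals of the compound Poisson process: `(ω k).1` is the waiting time
before the `k`-th shock (`k = 0, 1, …`), exponential of rate `Q`, and `(ω k).2` is the size of that
shock, of law `ν`; all of them are independent. -/
def shockLaw (M : StorageModel) : Measure (ℕ → ℝ × ℝ) :=
  Measure.infinitePi fun _ => (expMeasure M.Q).prod M.ν

/-- Time of arrival of the `k`-th shock. -/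
def arrivalTime (ω : ℕ → ℝ × ℝ) (k : ℕ) : ℝ := ∑ i ∈ Finset.range (k + 1), (ω i).1

/-- A feasible stationary Markov policy: at level `s`, a shock of size `w` is met by withdrawing
`μ s w` from the storage. Only the values on `[0, sbar] × [0, B]` matter. -/
structure IsPolicy (M : StorageModel) (μ : ℝ → ℝ → ℝ) : Prop where
  measurable : Measurable (Function.uncurry μ)
  feasible : ∀ s ∈ Icc 0 M.sbar, ∀ w ∈ Icc 0 M.B, μ s w ∈ Icc 0 (min s w)

/-- Storage level just before the `k`-th shock, under the policy `μ`, from the initial level `s`. -/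
def levelBefore (M : StorageModel) (μ : ℝ → ℝ → ℝ) (s : ℝ) (ω : ℕ → ℝ × ℝ) : ℕ → ℝ
  | 0 => M.refill s (ω 0).1
  | k + 1 =>
      M.refill (levelBefore M μ s ω k - μ (levelBefore M μ s ω k) (ω k).2) (ω (k + 1)).1

/-- Discounted cost of the blackout left by the `k`-th shock. -/
def blackoutCost (M : StorageModel) (μ : ℝ → ℝ → ℝ) (s : ℝ) (ω : ℕ → ℝ × ℝ) (k : ℕ) : ℝ :=
  Real.exp (-M.θ * arrivalTime ω k) * M.g ((ω k).2 - μ (M.levelBefore μ s ω k) (ω k).2)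

/-- `C_μ(s)`: expected discounted cost of blackouts under `μ` from the initial level `s`. -/
def policyCost (M : StorageModel) (μ : ℝ → ℝ → ℝ) (s : ℝ) : ℝ :=
  ∫ ω, ∑' k, M.blackoutCost μ s ω k ∂M.shockLaw

/-- `C(s)`: the optimal cost function, over all feasible stationary Markov policies. -/
def optCost (M : StorageModel) (s : ℝ) : ℝ :=
  sInf {c | ∃ μ, M.IsPolicy μ ∧ M.policyCost μ s = c}

/-- An optimal policy: it minimizes `C_μ(s)` over all policies, for every initial level `s`. -/
def IsOptimal (M : StorageModel) (μ : ℝ → ℝ → ℝ) : Prop :=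
  M.IsPolicy μ ∧ ∀ s ∈ Icc 0 M.sbar, ∀ μ', M.IsPolicy μ' → M.policyCost μ s ≤ M.policyCost μ' s

/-- `J_μ(s, w)`: cost under `μ` when a shock of size `w` arrives immediately at level `s`. -/
def jumpCost (M : StorageModel) (μ : ℝ → ℝ → ℝ) (s w : ℝ) : ℝ :=
  M.g (w - μ s w) + M.policyCost μ (s - μ s w)

/-- The value of the minimization problem `min_{u ∈ [0, min {s, w}]} g(w - u) + C(s - u)`. -/
def minCost (M : StorageModel) (s w : ℝ) : ℝ :=
  sInf ((fun u => M.g (w - u) + M.optCost (s - u)) '' Icc 0 (min s w))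

/-- `u` is feasible and achieves `min_{u ∈ [0, min {s, w}]} g(w - u) + C(s - u)`. -/
def Achieves (M : StorageModel) (s w u : ℝ) : Prop :=
  u ∈ Icc 0 (min s w) ∧
    IsMinOn (fun u => M.g (w - u) + M.optCost (s - u)) (Icc 0 (min s w)) u

end

end StorageModel

/-! The proof is dynamic programming, with the first shock as renewal time. If T is exponential of
rate Q, then `discounted Φ s` is the expectation of e^(-θT) Φ(level just before T), starting from s.
Conditioning on the first shock gives C_μ = `discounted (meanJumpCost μ)` (`extCost_eq`), and
`discounted` shrinks additive constants by the factor Q/(Q+θ) < 1. Hence the Bellman operator is a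
contraction of the bounded continuous functions (`contractingWith_bellman`). On [0, sbar] its fixed
point `value` lies below every C_μ and equals the cost of a measurable minimizing policy; both
follow by iterating an inequality whose defect decays geometrically (`le_of_discounted`). So C =
`value` there, and C inherits monotonicity and convexity from the Bellman iterates.

All differential equations come from one formula. In the level variable, `discounted Φ s` is e^(κs),
with κ = (Q+θ)/r, times an affine function of the integral of e^(-κx) Φ(x) over [s, sbar]
(`discounted_eq`). Its derivative is κ `discounted Φ s` - (Q/r) Φ(s) wherever Φ is continuous, and
almost everywhere for Φ merely bounded and measurable. For an optimal policy, comparing this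
derivative with that of `value` shows that its expected jump cost is minimal at almost every level.

Strict monotonicity is by contradiction: if C takes a value twice, it is constant from there up to
sbar. Let a be the lowest level with C(a) = C(sbar). The extra energy sbar - a must then be
worthless for almost every shock, yet for a positive shock it either reduces the blackout or shows
that C is already minimal below a. -/

namespace StorageModel

noncomputable section

open Filter Topology

/-! ### The extended stage cost, and discounting up to the next shock -/

/-- The stage cost, extended to the real line by its values at the end points of `[0, B]`. -/
def gExt (M : StorageModel) (x : ℝ) : ℝ := M.g (max 0 (min x M.B))

/-- Expected discounted value of `Φ` at the level just before the next shock. -/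
def discounted (M : StorageModel) (Φ : ℝ → ℝ) (s : ℝ) : ℝ :=
  ∫ h in Ioi (0 : ℝ), M.Q * Real.exp (-(M.Q + M.θ) * h) * Φ (M.refill s h)

/-- Expected discount factor at the first shock. -/
def discount (M : StorageModel) : ℝ := M.Q / (M.Q + M.θ)

variable (M : StorageModel)

theorem B_nonneg : 0 ≤ M.B := by
  have := M.isProb
  obtain ⟨w, hw⟩ := M.support.exists
  exact hw.1.trans hw.2

theorem clamp_mem (x : ℝ) : max 0 (min x M.B) ∈ Icc 0 M.B :=
  ⟨le_max_left _ _, max_le M.B_nonneg (min_le_right _ _)⟩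

theorem gExt_eq {x : ℝ} (hx : x ∈ Icc 0 M.B) : M.gExt x = M.g x := by
  rw [gExt, min_eq_left hx.2, max_eq_right hx.1]

/-- Clamping the argument makes the stage cost continuous and bounded on all of ℝ, so that
measurability and integrability can be settled without feasibility of the policy. -/
theorem continuous_gExt : Continuous M.gExt :=
  M.g_contDiff.continuousOn.comp_continuous (by fun_prop) M.clamp_mem

theorem gExt_nonneg (x : ℝ) : 0 ≤ M.gExt x := by
  rw [← M.g_zero]
  exact M.g_strictMono.monotoneOn ⟨le_rfl, M.B_nonneg⟩ (M.clamp_mem _) (M.clamp_mem _).1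

theorem gExt_le (x : ℝ) : M.gExt x ≤ M.g M.B :=
  M.g_strictMono.monotoneOn (M.clamp_mem _) ⟨M.B_nonneg, le_rfl⟩ (M.clamp_mem _).2

theorem abs_gExt_le (x : ℝ) : |M.gExt x| ≤ M.g M.B := by
  rw [abs_of_nonneg (M.gExt_nonneg x)]; exact M.gExt_le x

theorem sbar_mem : M.sbar ∈ Icc 0 M.sbar := ⟨M.sbar_pos.le, le_rfl⟩

theorem continuous_refill : Continuous fun p : ℝ × ℝ => M.refill p.1 p.2 := by
  unfold refill; fun_prop

theorem refill_mem {s h : ℝ} (hs : s ∈ Icc 0 M.sbar) (hh : 0 ≤ h) :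
    M.refill s h ∈ Icc 0 M.sbar :=
  ⟨le_min (by have := mul_nonneg M.r_pos.le hh; linarith [hs.1]) M.sbar_pos.le, min_le_right _ _⟩

theorem rate_pos : 0 < M.Q + M.θ := add_pos M.Q_pos M.θ_pos

theorem discount_pos : 0 < M.discount := div_pos M.Q_pos M.rate_pos

theorem discount_lt_one : M.discount < 1 := by
  rw [discount, div_lt_one M.rate_pos]; linarith [M.θ_pos]

theorem integrableOn_weight :
    IntegrableOn (fun h => M.Q * Real.exp (-(M.Q + M.θ) * h)) (Ioi 0) := by
  have := (integrableOn_exp_mul_Ioi (a := -(M.Q + M.θ)) (by linarith [M.rate_pos]) 0)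
  exact this.const_mul _

theorem integral_weight_Ioi (c : ℝ) : ∫ h in Ioi c, M.Q * Real.exp (-(M.Q + M.θ) * h) =
    M.discount * Real.exp (-(M.Q + M.θ) * c) := by
  rw [integral_const_mul, integral_exp_mul_Ioi (by linarith [M.rate_pos]), discount]
  have := M.rate_pos.ne'
  field_simp

theorem integral_weight : ∫ h in Ioi (0 : ℝ), M.Q * Real.exp (-(M.Q + M.θ) * h) = M.discount := by
  rw [integral_weight_Ioi]; simp

variable {M} {Φ Φ₁ Φ₂ : ℝ → ℝ} {C : ℝ}

theorem integrableOn_discounted (hm : Measurable Φ) (hC : ∀ x, |Φ x| ≤ C) (s : ℝ) :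
    IntegrableOn (fun h => M.Q * Real.exp (-(M.Q + M.θ) * h) * Φ (M.refill s h)) (Ioi 0) := by
  refine Integrable.mul_bdd (c := C) M.integrableOn_weight ?_ ?_
  · exact (hm.comp (M.continuous_refill.measurable.comp measurable_prodMk_left)).aestronglyMeasurable
  · exact Eventually.of_forall fun h => hC _

theorem discounted_le (hm₁ : Measurable Φ₁) (hm₂ : Measurable Φ₂) {C₁ C₂ : ℝ}
    (hC₁ : ∀ x, |Φ₁ x| ≤ C₁) (hC₂ : ∀ x, |Φ₂ x| ≤ C₂) {c s : ℝ} (hs : s ∈ Icc 0 M.sbar)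
    (h : ∀ x ∈ Icc 0 M.sbar, Φ₁ x ≤ Φ₂ x + c) :
    M.discounted Φ₁ s ≤ M.discounted Φ₂ s + M.discount * c := by
  rw [← M.integral_weight, discounted, discounted, ← integral_mul_const, ← integral_add
    (integrableOn_discounted hm₂ hC₂ s) (M.integrableOn_weight.mul_const c)]
  refine setIntegral_mono_on (integrableOn_discounted hm₁ hC₁ s)
    ((integrableOn_discounted hm₂ hC₂ s).add (M.integrableOn_weight.mul_const c))
    measurableSet_Ioi fun t ht => ?_
  have h1 := h _ (M.refill_mem hs (le_of_lt ht))
  have h2 : 0 ≤ M.Q * Real.exp (-(M.Q + M.θ) * t) := mul_nonneg M.Q_pos.le (Real.exp_pos _).le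
  rw [← mul_add]
  exact mul_le_mul_of_nonneg_left h1 h2

theorem abs_discounted_le (hC : ∀ x, |Φ x| ≤ C) (s : ℝ) :
    |M.discounted Φ s| ≤ M.discount * C := by
  rw [← M.integral_weight, ← integral_mul_const, discounted, ← Real.norm_eq_abs]
  refine norm_integral_le_of_norm_le (M.integrableOn_weight.mul_const C)
    (Eventually.of_forall fun t => ?_)
  have h2 : 0 ≤ M.Q * Real.exp (-(M.Q + M.θ) * t) := mul_nonneg M.Q_pos.le (Real.exp_pos _).le
  rw [norm_mul, Real.norm_of_nonneg h2]
  exact mul_le_mul_of_nonneg_left (hC _) h2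

theorem continuous_discounted (hc : Continuous Φ) (hC : ∀ x, |Φ x| ≤ C) :
    Continuous (M.discounted Φ) := by
  refine continuous_of_dominated
    (bound := fun h => M.Q * Real.exp (-(M.Q + M.θ) * h) * C) (fun s => ?_) (fun s => ?_)
    (M.integrableOn_weight.mul_const C) ?_
  · exact (integrableOn_discounted hc.measurable hC s).aestronglyMeasurable
  · refine Eventually.of_forall fun t => ?_
    have h2 : 0 ≤ M.Q * Real.exp (-(M.Q + M.θ) * t) := mul_nonneg M.Q_pos.le (Real.exp_pos _).le
    rw [norm_mul, Real.norm_of_nonneg h2]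
    exact mul_le_mul_of_nonneg_left (hC _) h2
  · exact Eventually.of_forall fun t => continuous_const.mul
      (hc.comp (M.continuous_refill.comp (by fun_prop : Continuous fun s : ℝ => (s, t))))

theorem discounted_sbar (Φ : ℝ → ℝ) : M.discounted Φ M.sbar = M.discount * Φ M.sbar := by
  rw [← M.integral_weight, ← integral_mul_const, discounted]
  refine setIntegral_congr_fun measurableSet_Ioi fun t ht => ?_
  have : M.refill M.sbar t = M.sbar :=
    min_eq_right (by have := mul_nonneg M.r_pos.le (le_of_lt ht); linarith)
  simp only [this]

/-- The discounted value in terms of the levels run through by the storage. -/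
theorem discounted_eq (hm : Measurable Φ) (hC : ∀ x, |Φ x| ≤ C) {s : ℝ} (hs : s ≤ M.sbar) :
    M.discounted Φ s = Real.exp ((M.Q + M.θ) / M.r * s) *
      (M.Q / M.r * (∫ x in s..M.sbar, Real.exp (-((M.Q + M.θ) / M.r) * x) * Φ x) +
        Real.exp (-((M.Q + M.θ) / M.r) * M.sbar) * (M.discount * Φ M.sbar)) := by
  have hr := M.r_pos
  -- τ is the time at which the storage becomes full: before it the level x = s + r t serves as
  -- integration variable, after it Φ is evaluated at `sbar` only.
  set τ := (M.sbar - s) / M.r with hτ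
  have hτ0 : 0 ≤ τ := div_nonneg (by linarith) hr.le
  have hrτ : M.r * τ = M.sbar - s := by rw [hτ]; field_simp
  have hi := integrableOn_discounted (M := M) hm hC s
  rw [discounted, ← Ioc_union_Ioi_eq_Ioi hτ0, setIntegral_union (Ioc_disjoint_Ioi le_rfl)
    measurableSet_Ioi (hi.mono_set Ioc_subset_Ioi_self) (hi.mono_set (Ioi_subset_Ioi hτ0)),
    mul_add]
  congr 1
  · have e : ∀ t ∈ uIcc 0 τ, M.Q * Real.exp (-(M.Q + M.θ) * t) * Φ (M.refill s t) =
        Real.exp ((M.Q + M.θ) / M.r * s) * M.Q *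
          (fun x => Real.exp (-((M.Q + M.θ) / M.r) * x) * Φ x) (M.r * t + s) := by
      intro t ht
      rw [uIcc_of_le hτ0] at ht
      have h1 : M.refill s t = M.r * t + s := by
        rw [refill, min_eq_left]
        · ring
        · have := mul_le_mul_of_nonneg_left ht.2 hr.le; linarith
      have h2 : Real.exp (-(M.Q + M.θ) * t) = Real.exp ((M.Q + M.θ) / M.r * s) *
          Real.exp (-((M.Q + M.θ) / M.r) * (M.r * t + s)) := by
        rw [← Real.exp_add]; congr 1; field_simp; ring
      simp only [h1, h2]; ring
    rw [← intervalIntegral.integral_of_le hτ0, intervalIntegral.integral_congr e,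
      intervalIntegral.integral_const_mul,
      intervalIntegral.integral_comp_mul_add
        (fun x => Real.exp (-((M.Q + M.θ) / M.r) * x) * Φ x) hr.ne', hrτ]
    simp only [mul_zero, zero_add, sub_add_cancel, smul_eq_mul]
    ring
  · have e : ∀ t ∈ Ioi τ, M.Q * Real.exp (-(M.Q + M.θ) * t) * Φ (M.refill s t) =
        M.Q * Real.exp (-(M.Q + M.θ) * t) * Φ M.sbar := by
      intro t ht
      have : M.refill s t = M.sbar := by
        rw [refill, min_eq_right]
        have := mul_le_mul_of_nonneg_left (le_of_lt ht) hr.le; linarith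
      rw [this]
    rw [setIntegral_congr_fun measurableSet_Ioi e, integral_mul_const, integral_weight_Ioi,
      ← mul_assoc, ← Real.exp_add]
    have : -(M.Q + M.θ) * τ = (M.Q + M.θ) / M.r * s + -((M.Q + M.θ) / M.r) * M.sbar := by
      rw [hτ]; field_simp; ring
    rw [this]; ring

theorem intervalIntegrable_weighted (hm : Measurable Φ) (hC : ∀ x, |Φ x| ≤ C) (κ a b : ℝ) :
    IntervalIntegrable (fun x => Real.exp (κ * x) * Φ x) volume a b := by
  have h : IntervalIntegrable (fun x => Real.exp (κ * x)) volume a b :=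
    (by fun_prop : Continuous fun x => Real.exp (κ * x)).intervalIntegrable _ _
  exact ⟨h.1.mul_bdd hm.aestronglyMeasurable (Eventually.of_forall hC),
    h.2.mul_bdd hm.aestronglyMeasurable (Eventually.of_forall hC)⟩

/-- The product rule applied to `discounted_eq`. The derivative of the integral is left as a
hypothesis because it has two sources: continuity of Φ at s, or Lebesgue differentiation at almost
every s. -/
theorem hasDerivWithinAt_discounted_of_integral (hm : Measurable Φ) (hC : ∀ x, |Φ x| ≤ C) {s : ℝ}
    (hs : s ∈ Icc 0 M.sbar)
    (h : HasDerivWithinAt (fun u => ∫ x in u..M.sbar, Real.exp (-((M.Q + M.θ) / M.r) * x) * Φ x)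
      (-(Real.exp (-((M.Q + M.θ) / M.r) * s) * Φ s)) (Icc 0 M.sbar) s) :
    HasDerivWithinAt (M.discounted Φ)
      ((M.Q + M.θ) / M.r * M.discounted Φ s - M.Q / M.r * Φ s) (Icc 0 M.sbar) s := by
  have h1 : HasDerivWithinAt (fun s => Real.exp ((M.Q + M.θ) / M.r * s))
      (Real.exp ((M.Q + M.θ) / M.r * s) * ((M.Q + M.θ) / M.r * 1)) (Icc 0 M.sbar) s :=
    ((hasDerivAt_id s).const_mul _).exp.hasDerivWithinAt
  have h2 := h1.mul ((h.const_mul (M.Q / M.r)).add_const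
    (Real.exp (-((M.Q + M.θ) / M.r) * M.sbar) * (M.discount * Φ M.sbar)))
  refine (h2.congr_deriv ?_).congr (fun x hx => ?_) ?_
  · rw [discounted_eq hm hC hs.2]
    have : Real.exp ((M.Q + M.θ) / M.r * s) * Real.exp (-((M.Q + M.θ) / M.r) * s) = 1 := by
      rw [← Real.exp_add]; simp
    linear_combination (-(M.Q / M.r * Φ s)) * this
  · exact discounted_eq hm hC hx.2
  · exact discounted_eq hm hC hs.2

theorem hasDerivWithinAt_discounted (hm : Measurable Φ) (hC : ∀ x, |Φ x| ≤ C) {s : ℝ}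
    (hs : s ∈ Icc 0 M.sbar) (hc : ContinuousWithinAt Φ (Icc 0 M.sbar) s) :
    HasDerivWithinAt (M.discounted Φ)
      ((M.Q + M.θ) / M.r * M.discounted Φ s - M.Q / M.r * Φ s) (Icc 0 M.sbar) s := by
  have : Fact (s ∈ Icc 0 M.sbar) := ⟨hs⟩
  refine hasDerivWithinAt_discounted_of_integral hm hC hs
    (intervalIntegral.integral_hasDerivWithinAt_left (t := Icc 0 M.sbar)
      (intervalIntegrable_weighted hm hC _ _ _) ?_ ?_)
  · exact (Measurable.stronglyMeasurable
      (by fun_prop)).aestronglyMeasurable.stronglyMeasurableAtFilter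
  · exact (by fun_prop : Continuous fun x =>
      Real.exp (-((M.Q + M.θ) / M.r) * x)).continuousWithinAt.mul hc

theorem ae_hasDerivWithinAt_discounted (hm : Measurable Φ) (hC : ∀ x, |Φ x| ≤ C) :
    ∀ᵐ s ∂(volume.restrict (Icc 0 M.sbar)), HasDerivWithinAt (M.discounted Φ)
      ((M.Q + M.θ) / M.r * M.discounted Φ s - M.Q / M.r * Φ s) (Icc 0 M.sbar) s := by
  have h := (intervalIntegrable_weighted hm hC
    (-((M.Q + M.θ) / M.r)) 0 M.sbar).ae_hasDerivAt_integral
  rw [ae_restrict_iff' measurableSet_Icc]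
  filter_upwards [h] with s hs hmem
  have h1 := hs (by rwa [uIcc_of_le M.sbar_pos.le]) M.sbar (by simp)
  refine hasDerivWithinAt_discounted_of_integral hm hC hmem ?_
  simp only [intervalIntegral.integral_symm M.sbar]
  exact h1.neg.hasDerivWithinAt

/-- Discounting smooths: a primitive is continuous even if Φ is not. This makes the cost of every
policy continuous in the level. -/
theorem continuousOn_discounted (hm : Measurable Φ) (hC : ∀ x, |Φ x| ≤ C) :
    ContinuousOn (M.discounted Φ) (Icc 0 M.sbar) := by
  have h : ContinuousOn (fun s => Real.exp ((M.Q + M.θ) / M.r * s) *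
      (M.Q / M.r * (∫ x in s..M.sbar, Real.exp (-((M.Q + M.θ) / M.r) * x) * Φ x) +
        Real.exp (-((M.Q + M.θ) / M.r) * M.sbar) * (M.discount * Φ M.sbar))) (Icc 0 M.sbar) := by
    have h0 : ContinuousOn (fun s => ∫ x in s..M.sbar,
        Real.exp (-((M.Q + M.θ) / M.r) * x) * Φ x) (Icc 0 M.sbar) := by
      simp only [intervalIntegral.integral_symm M.sbar]
      exact (intervalIntegral.continuous_primitive
        (intervalIntegrable_weighted hm hC _) M.sbar).neg.continuousOn
    have h1 : ContinuousOn (fun s => Real.exp ((M.Q + M.θ) / M.r * s)) (Icc 0 M.sbar) := by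
      fun_prop
    exact h1.mul ((continuousOn_const.mul h0).add continuousOn_const)
  exact h.congr fun x hx => discounted_eq hm hC hx.2

end

end StorageModel

/-! ### Splitting off the first term of an i.i.d. sequence -/

/-- The sequence with first term `p.1`, followed by the sequence `p.2`. -/
def consSeq {α : Type*} (p : α × (ℕ → α)) : ℕ → α
  | 0 => p.1
  | k + 1 => p.2 k

theorem measurable_consSeq {α : Type*} [MeasurableSpace α] :
    Measurable (consSeq : α × (ℕ → α) → ℕ → α) := by
  refine measurable_pi_iff.2 fun k => ?_
  cases k with
  | zero => exact measurable_fst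
  | succ k => exact (measurable_pi_apply k).comp measurable_snd

/-- Prepending an independent term of the same law to an i.i.d. sequence gives such a sequence. -/
theorem measurePreserving_consSeq {α : Type*} [MeasurableSpace α] (ρ : Measure α)
    [IsProbabilityMeasure ρ] :
    MeasurePreserving consSeq (ρ.prod (Measure.infinitePi fun _ : ℕ => ρ))
      (Measure.infinitePi fun _ : ℕ => ρ) := by
  classical
  refine ⟨measurable_consSeq, Measure.eq_infinitePi _ fun s t ht => ?_⟩
  obtain ⟨N, hN⟩ : ∃ N, s ⊆ Finset.range (N + 1) :=
    ⟨s.sup id, fun i hi => Finset.mem_range_succ_iff.2 (Finset.le_sup (f := id) hi)⟩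
  -- Padding with `univ` turns an arbitrary finite index set into an initial segment, whose cylinder
  -- splits into a condition on the first term and a cylinder for the shifted sequence.
  set t' : ℕ → Set α := fun i => if i ∈ s then t i else univ with ht'
  have hm : ∀ i, MeasurableSet (t' i) := fun i => by
    by_cases hi : i ∈ s <;> simp [ht', hi, ht]
  have e1 : (s : Set ℕ).pi t = (Finset.range (N + 1) : Set ℕ).pi t' := by
    ext f
    simp only [Set.mem_pi, Finset.mem_coe, ht']
    constructor
    · intro h i _
      by_cases hi : i ∈ s
      · simpa [hi] using h i hi
      · simp [hi]
    · intro h i hi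
      simpa [hi] using h i (hN hi)
  have e2 : ∏ i ∈ s, ρ (t i) = ∏ i ∈ Finset.range (N + 1), ρ (t' i) := by
    rw [← Finset.prod_subset hN]
    · exact Finset.prod_congr rfl fun i hi => by simp [ht', hi]
    · intro i _ hi
      simp [ht', hi]
  have e3 : consSeq ⁻¹' ((Finset.range (N + 1) : Set ℕ).pi t') =
      t' 0 ×ˢ ((Finset.range N : Set ℕ).pi fun i => t' (i + 1)) := by
    ext p
    simp only [mem_preimage, Set.mem_pi, Finset.mem_coe, Finset.mem_range, mem_prod]
    constructor
    · intro h
      exact ⟨h 0 (by omega), fun i hi => h (i + 1) (by omega)⟩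
    · rintro ⟨h0, h1⟩ (_ | i) hi
      · exact h0
      · exact h1 i (by omega)
  rw [e1, e2, Measure.map_apply measurable_consSeq
    (.pi (Finset.countable_toSet _) fun i _ => hm i), e3, Measure.prod_prod,
    Measure.infinitePi_pi _ fun i _ => hm _, Finset.prod_range_succ', mul_comm]

/-! ### Well-posedness of the policy costs and first-step analysis -/

namespace StorageModel

noncomputable section

open Filter Topology

variable (M : StorageModel)

instance : IsProbabilityMeasure M.ν := M.isProb

instance : IsProbabilityMeasure (expMeasure M.Q) := isProbabilityMeasure_expMeasure M.Q_pos

instance : IsProbabilityMeasure M.shockLaw := by unfold shockLaw; infer_instance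

theorem measurePreserving_consSeq_shockLaw :
    MeasurePreserving consSeq (((expMeasure M.Q).prod M.ν).prod M.shockLaw) M.shockLaw :=
  measurePreserving_consSeq _

theorem integral_expMeasure (f : ℝ → ℝ) :
    ∫ h, f h ∂(expMeasure M.Q) = ∫ h in Ioi (0 : ℝ), M.Q * Real.exp (-(M.Q * h)) * f h := by
  have hm : Measurable (exponentialPDF M.Q) :=
    (measurable_exponentialPDFReal M.Q).ennreal_ofReal
  change ∫ h, f h ∂(volume.withDensity (exponentialPDF M.Q)) = _
  rw [integral_withDensity_eq_integral_toReal_smul hm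
    (Eventually.of_forall fun _ => ENNReal.ofReal_lt_top), ← integral_Ici_eq_integral_Ioi,
    ← integral_indicator measurableSet_Ici]
  refine integral_congr_ae (Eventually.of_forall fun h => ?_)
  by_cases hh : 0 ≤ h
  · have h0 : 0 ≤ M.Q * Real.exp (-(M.Q * h)) := mul_nonneg M.Q_pos.le (Real.exp_pos _).le
    simp only [exponentialPDF_of_nonneg hh, indicator_of_mem (mem_Ici.2 hh),
      ENNReal.toReal_ofReal h0, smul_eq_mul]
  · simp only [exponentialPDF_of_neg (not_le.1 hh), indicator_of_notMem (mt mem_Ici.1 hh),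
      ENNReal.toReal_zero, zero_smul]

theorem ae_expMeasure_nonneg : ∀ᵐ h ∂(expMeasure M.Q), 0 ≤ h := by
  have hm : Measurable (exponentialPDF M.Q) :=
    (measurable_exponentialPDFReal M.Q).ennreal_ofReal
  change ∀ᵐ h ∂(volume.withDensity (exponentialPDF M.Q)), 0 ≤ h
  rw [ae_withDensity_iff hm]
  refine Eventually.of_forall fun h hne => ?_
  by_contra hh
  exact hne (exponentialPDF_of_neg (not_le.1 hh))

theorem integrable_exp_neg_expMeasure :
    Integrable (fun h => Real.exp (-M.θ * h)) (expMeasure M.Q) := by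
  refine Integrable.of_bound (C := 1) (by fun_prop) ?_
  filter_upwards [M.ae_expMeasure_nonneg] with h hh
  rw [Real.norm_of_nonneg (Real.exp_pos _).le, Real.exp_le_one_iff]
  have := mul_nonneg M.θ_pos.le hh
  linarith

theorem integral_exp_neg_expMeasure :
    ∫ h, Real.exp (-M.θ * h) ∂(expMeasure M.Q) = M.discount := by
  rw [integral_expMeasure, ← M.integral_weight]
  refine setIntegral_congr_fun measurableSet_Ioi fun h _ => ?_
  simp only [mul_assoc, ← Real.exp_add]
  ring_nf

theorem integral_expMeasure_discounted (Φ : ℝ → ℝ) (s : ℝ) :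
    ∫ h, Real.exp (-M.θ * h) * Φ (M.refill s h) ∂(expMeasure M.Q) = M.discounted Φ s := by
  rw [integral_expMeasure, discounted]
  refine setIntegral_congr_fun measurableSet_Ioi fun h _ => ?_
  rw [← mul_assoc, mul_assoc M.Q, ← Real.exp_add]
  ring_nf

theorem arrivalTime_consSeq_zero (p : (ℝ × ℝ) × (ℕ → ℝ × ℝ)) :
    arrivalTime (consSeq p) 0 = p.1.1 := by
  simp [arrivalTime, consSeq]

theorem arrivalTime_consSeq_succ (p : (ℝ × ℝ) × (ℕ → ℝ × ℝ)) (k : ℕ) :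
    arrivalTime (consSeq p) (k + 1) = p.1.1 + arrivalTime p.2 k := by
  rw [arrivalTime, Finset.sum_range_succ', add_comm]
  rfl

theorem measurable_arrivalTime (k : ℕ) : Measurable fun ω => arrivalTime ω k := by
  unfold arrivalTime
  fun_prop

theorem measurable_exp_neg_arrivalTime (k : ℕ) :
    Measurable fun ω => ENNReal.ofReal (Real.exp (-M.θ * arrivalTime ω k)) :=
  (Real.measurable_exp.comp ((measurable_arrivalTime k).const_mul _)).ennreal_ofReal

theorem lintegral_exp_neg_fst :
    ∫⁻ a : ℝ × ℝ, ENNReal.ofReal (Real.exp (-M.θ * a.1)) ∂((expMeasure M.Q).prod M.ν) =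
      ENNReal.ofReal M.discount := by
  rw [lintegral_prod _ (by fun_prop)]
  simp only [lintegral_const, measure_univ, mul_one]
  rw [← ofReal_integral_eq_lintegral_ofReal M.integrable_exp_neg_expMeasure
    (Eventually.of_forall fun _ => (Real.exp_pos _).le), M.integral_exp_neg_expMeasure]

/-- The arrival time with index k is a sum of k + 1 independent waiting times, each contributing a
factor `discount`. The resulting geometric series bounds the costs of all policies at once. -/
theorem lintegral_exp_neg_arrivalTime (k : ℕ) :
    ∫⁻ ω, ENNReal.ofReal (Real.exp (-M.θ * arrivalTime ω k)) ∂M.shockLaw =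
      ENNReal.ofReal M.discount ^ (k + 1) := by
  have hm := M.measurable_exp_neg_arrivalTime
  induction k with
  | zero =>
    rw [← M.measurePreserving_consSeq_shockLaw.lintegral_comp (hm 0)]
    simp only [arrivalTime_consSeq_zero]
    rw [lintegral_prod _ (by fun_prop)]
    simp only [lintegral_const, measure_univ, mul_one]
    rw [lintegral_exp_neg_fst, zero_add, pow_one]
  | succ k ih =>
    rw [← M.measurePreserving_consSeq_shockLaw.lintegral_comp (hm (k + 1))]
    simp only [arrivalTime_consSeq_succ, mul_add, Real.exp_add,
      ENNReal.ofReal_mul (Real.exp_pos _).le]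
    rw [lintegral_prod_mul (f := fun a : ℝ × ℝ => ENNReal.ofReal (Real.exp (-M.θ * a.1)))
      (g := fun ω => ENNReal.ofReal (Real.exp (-M.θ * arrivalTime ω k))) (by fun_prop)
      (hm k).aemeasurable, ih, lintegral_exp_neg_fst, pow_succ' _ (k + 1)]

/-- Sum of the discount factors at all shocks. -/
def totalDiscount (ω : ℕ → ℝ × ℝ) : ENNReal :=
  ∑' k, ENNReal.ofReal (Real.exp (-M.θ * arrivalTime ω k))

theorem lintegral_totalDiscount_ne_top : ∫⁻ ω, M.totalDiscount ω ∂M.shockLaw ≠ ⊤ := by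
  unfold totalDiscount
  rw [lintegral_tsum fun k => (M.measurable_exp_neg_arrivalTime k).aemeasurable]
  simp only [lintegral_exp_neg_arrivalTime, pow_succ']
  rw [ENNReal.tsum_mul_left]
  refine ENNReal.mul_ne_top ENNReal.ofReal_ne_top ?_
  rw [ENNReal.tsum_geometric]
  refine ENNReal.inv_ne_top.2 (tsub_pos_of_lt ?_).ne'
  rw [← ENNReal.ofReal_one]
  exact (ENNReal.ofReal_lt_ofReal_iff one_pos).2 M.discount_lt_one

theorem measurable_totalDiscount : Measurable M.totalDiscount :=
  Measurable.tsum M.measurable_exp_neg_arrivalTime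

theorem ae_totalDiscount_lt_top : ∀ᵐ ω ∂M.shockLaw, M.totalDiscount ω < ⊤ :=
  ae_lt_top M.measurable_totalDiscount M.lintegral_totalDiscount_ne_top

theorem integrable_totalDiscount :
    Integrable (fun ω => (M.totalDiscount ω).toReal) M.shockLaw :=
  integrable_toReal_of_lintegral_ne_top M.measurable_totalDiscount.aemeasurable
    M.lintegral_totalDiscount_ne_top

variable (μ : ℝ → ℝ → ℝ)

/-- `blackoutCost` with the extended stage cost. -/
def extBlackoutCost (s : ℝ) (ω : ℕ → ℝ × ℝ) (k : ℕ) : ℝ :=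
  Real.exp (-M.θ * arrivalTime ω k) * M.gExt ((ω k).2 - μ (M.levelBefore μ s ω k) (ω k).2)

/-- `policyCost` with the extended stage cost. -/
def extCost (s : ℝ) : ℝ := ∫ ω, ∑' k, M.extBlackoutCost μ s ω k ∂M.shockLaw

/-- `jumpCost` with the extended stage cost. -/
def extJumpCost (s w : ℝ) : ℝ := M.gExt (w - μ s w) + M.extCost μ (s - μ s w)

/-- Expected cost when a shock arrives at level `s`. -/
def meanJumpCost (s : ℝ) : ℝ := ∫ w, M.extJumpCost μ s w ∂M.ν

/-- An upper bound of the cost of all policies. -/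
def costBound : ℝ := M.g M.B * ∫ ω, (M.totalDiscount ω).toReal ∂M.shockLaw

theorem extBlackoutCost_nonneg (s : ℝ) (ω : ℕ → ℝ × ℝ) (k : ℕ) :
    0 ≤ M.extBlackoutCost μ s ω k :=
  mul_nonneg (Real.exp_pos _).le (M.gExt_nonneg _)

theorem extBlackoutCost_le (s : ℝ) (ω : ℕ → ℝ × ℝ) (k : ℕ) :
    M.extBlackoutCost μ s ω k ≤ M.g M.B * Real.exp (-M.θ * arrivalTime ω k) := by
  rw [mul_comm, extBlackoutCost]
  exact mul_le_mul_of_nonneg_left (M.gExt_le _) (Real.exp_pos _).le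

theorem hasSum_totalDiscount {ω : ℕ → ℝ × ℝ} (h : M.totalDiscount ω < ⊤) :
    HasSum (fun k => Real.exp (-M.θ * arrivalTime ω k)) (M.totalDiscount ω).toReal := by
  have h1 := ENNReal.hasSum_toReal h.ne
  rw [totalDiscount, ENNReal.tsum_toReal_eq fun _ => ENNReal.ofReal_ne_top]
  simpa only [ENNReal.toReal_ofReal (Real.exp_pos _).le] using h1

theorem summable_extBlackoutCost {ω : ℕ → ℝ × ℝ} (h : M.totalDiscount ω < ⊤) (s : ℝ) :
    Summable (M.extBlackoutCost μ s ω) :=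
  Summable.of_nonneg_of_le (M.extBlackoutCost_nonneg μ s ω) (M.extBlackoutCost_le μ s ω)
    ((M.hasSum_totalDiscount h).summable.mul_left _)

theorem tsum_extBlackoutCost_le {ω : ℕ → ℝ × ℝ} (h : M.totalDiscount ω < ⊤) (s : ℝ) :
    ∑' k, M.extBlackoutCost μ s ω k ≤ M.g M.B * (M.totalDiscount ω).toReal := by
  rw [← (M.hasSum_totalDiscount h).tsum_eq, ← tsum_mul_left]
  exact (M.summable_extBlackoutCost μ h s).tsum_le_tsum (M.extBlackoutCost_le μ s ω)
    ((M.hasSum_totalDiscount h).summable.mul_left _)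

variable {μ}

theorem measurable_levelBefore (hμ : Measurable (Function.uncurry μ)) (k : ℕ) :
    Measurable fun p : ℝ × (ℕ → ℝ × ℝ) => M.levelBefore μ p.1 p.2 k := by
  induction k with
  | zero =>
    exact M.continuous_refill.measurable.comp
      (measurable_fst.prodMk ((measurable_pi_apply 0).comp measurable_snd).fst)
  | succ k ih =>
    have hw : ∀ i, Measurable fun p : ℝ × (ℕ → ℝ × ℝ) => p.2 i := fun i =>
      (measurable_pi_apply i).comp measurable_snd
    exact M.continuous_refill.measurable.comp
      ((ih.sub (hμ.comp (ih.prodMk (hw k).snd))).prodMk (hw (k + 1)).fst)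

theorem measurable_extBlackoutCost (hμ : Measurable (Function.uncurry μ)) (k : ℕ) :
    Measurable fun p : ℝ × (ℕ → ℝ × ℝ) => M.extBlackoutCost μ p.1 p.2 k := by
  have hw : Measurable fun p : ℝ × (ℕ → ℝ × ℝ) => (p.2 k).2 :=
    ((measurable_pi_apply k).comp measurable_snd).snd
  exact (Real.measurable_exp.comp
    (((measurable_arrivalTime k).comp measurable_snd).const_mul _)).mul
    (M.continuous_gExt.measurable.comp
      (hw.sub (hμ.comp ((M.measurable_levelBefore hμ k).prodMk hw))))

theorem measurable_tsum_extBlackoutCost (hμ : Measurable (Function.uncurry μ)) :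
    Measurable fun p : ℝ × (ℕ → ℝ × ℝ) => ∑' k, M.extBlackoutCost μ p.1 p.2 k := by
  -- Passing through extended nonnegative sums avoids summability: where the series diverges, both
  -- sides are 0.
  have e : (fun p : ℝ × (ℕ → ℝ × ℝ) => ∑' k, M.extBlackoutCost μ p.1 p.2 k) =
      fun p => (∑' k, ENNReal.ofReal (M.extBlackoutCost μ p.1 p.2 k)).toReal := by
    funext p
    rw [ENNReal.tsum_toReal_eq fun _ => ENNReal.ofReal_ne_top]
    simp only [ENNReal.toReal_ofReal (M.extBlackoutCost_nonneg _ _ _ _)]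
  rw [e]
  exact (Measurable.tsum fun k =>
    (M.measurable_extBlackoutCost hμ k).ennreal_ofReal).ennreal_toReal

theorem integrable_tsum_extBlackoutCost (hμ : Measurable (Function.uncurry μ)) (s : ℝ) :
    Integrable (fun ω => ∑' k, M.extBlackoutCost μ s ω k) M.shockLaw := by
  refine (M.integrable_totalDiscount.const_mul (M.g M.B)).mono'
    ((M.measurable_tsum_extBlackoutCost hμ).comp measurable_prodMk_left).aestronglyMeasurable ?_
  filter_upwards [M.ae_totalDiscount_lt_top] with ω hω
  rw [Real.norm_of_nonneg (tsum_nonneg (M.extBlackoutCost_nonneg μ s ω))]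
  exact M.tsum_extBlackoutCost_le μ hω s

theorem measurable_extCost (hμ : Measurable (Function.uncurry μ)) : Measurable (M.extCost μ) :=
  ((M.measurable_tsum_extBlackoutCost hμ).stronglyMeasurable.integral_prod_right).measurable

theorem abs_extCost_le (s : ℝ) : |M.extCost μ s| ≤ M.costBound := by
  rw [extCost, costBound, ← integral_const_mul, ← Real.norm_eq_abs]
  refine norm_integral_le_of_norm_le (M.integrable_totalDiscount.const_mul _) ?_
  filter_upwards [M.ae_totalDiscount_lt_top] with ω hω
  rw [Real.norm_of_nonneg (tsum_nonneg (M.extBlackoutCost_nonneg μ s ω))]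
  exact M.tsum_extBlackoutCost_le μ hω s

theorem measurable_extJumpCost (hμ : Measurable (Function.uncurry μ)) :
    Measurable (Function.uncurry (M.extJumpCost μ)) :=
  (M.continuous_gExt.measurable.comp (measurable_snd.sub hμ)).add
    ((M.measurable_extCost hμ).comp (measurable_fst.sub hμ))

theorem abs_extJumpCost_le (s w : ℝ) : |M.extJumpCost μ s w| ≤ M.g M.B + M.costBound :=
  (abs_add_le _ _).trans (add_le_add (M.abs_gExt_le _) (M.abs_extCost_le _))

theorem integrable_extJumpCost (hμ : Measurable (Function.uncurry μ)) (s : ℝ) :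
    Integrable (M.extJumpCost μ s) M.ν :=
  Integrable.of_bound
    ((M.measurable_extJumpCost hμ).comp measurable_prodMk_left).aestronglyMeasurable _
    (Eventually.of_forall (M.abs_extJumpCost_le s))

theorem measurable_meanJumpCost (hμ : Measurable (Function.uncurry μ)) :
    Measurable (M.meanJumpCost μ) :=
  ((M.measurable_extJumpCost hμ).stronglyMeasurable.integral_prod_right).measurable

theorem abs_meanJumpCost_le (s : ℝ) : |M.meanJumpCost μ s| ≤ M.g M.B + M.costBound := by
  have h := norm_integral_le_of_norm_le_const (μ := M.ν) (f := M.extJumpCost μ s)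
    (Eventually.of_forall (M.abs_extJumpCost_le s))
  rwa [probReal_univ, mul_one] at h

/-- After the first shock the trajectory restarts from the level that this shock leaves, driven by
the shifted sequence. -/
theorem levelBefore_consSeq_succ (s : ℝ) (a : ℝ × ℝ) (ω : ℕ → ℝ × ℝ) (k : ℕ) :
    M.levelBefore μ s (consSeq (a, ω)) (k + 1) =
      M.levelBefore μ (M.refill s a.1 - μ (M.refill s a.1) a.2) ω k := by
  induction k with
  | zero => rfl
  | succ k ih =>
    rw [levelBefore, ih]
    rfl

theorem extBlackoutCost_consSeq_zero (s : ℝ) (a : ℝ × ℝ) (ω : ℕ → ℝ × ℝ) :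
    M.extBlackoutCost μ s (consSeq (a, ω)) 0 =
      Real.exp (-M.θ * a.1) * M.gExt (a.2 - μ (M.refill s a.1) a.2) := by
  rw [extBlackoutCost, arrivalTime_consSeq_zero]
  rfl

theorem extBlackoutCost_consSeq_succ (s : ℝ) (a : ℝ × ℝ) (ω : ℕ → ℝ × ℝ) (k : ℕ) :
    M.extBlackoutCost μ s (consSeq (a, ω)) (k + 1) = Real.exp (-M.θ * a.1) *
      M.extBlackoutCost μ (M.refill s a.1 - μ (M.refill s a.1) a.2) ω k := by
  rw [extBlackoutCost, arrivalTime_consSeq_succ, levelBefore_consSeq_succ, mul_add, Real.exp_add,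
    mul_assoc]
  rfl

/-- First-step analysis: the cost of a policy is its expected discounted cost at the first shock. -/
theorem extCost_eq (hμ : Measurable (Function.uncurry μ)) (s : ℝ) :
    M.extCost μ s = M.discounted (M.meanJumpCost μ) s := by
  have mp := M.measurePreserving_consSeq_shockLaw
  set F : (ℕ → ℝ × ℝ) → ℝ := fun ω => ∑' k, M.extBlackoutCost μ s ω k with hF
  have hi : Integrable F M.shockLaw := M.integrable_tsum_extBlackoutCost hμ s
  set G : (ℝ × ℝ) × (ℕ → ℝ × ℝ) → ℝ := fun p => Real.exp (-M.θ * p.1.1) *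
    (M.gExt (p.1.2 - μ (M.refill s p.1.1) p.1.2) + ∑' k, M.extBlackoutCost μ
      (M.refill s p.1.1 - μ (M.refill s p.1.1) p.1.2) p.2 k) with hG
  -- Taking the first shock out of the series needs summability, so the identity holds almost surely
  -- only.
  have hFG : F ∘ consSeq =ᵐ[((expMeasure M.Q).prod M.ν).prod M.shockLaw] G := by
    have hs : ∀ᵐ p ∂(((expMeasure M.Q).prod M.ν).prod M.shockLaw),
        M.totalDiscount (consSeq p) < ⊤ := mp.quasiMeasurePreserving.ae M.ae_totalDiscount_lt_top
    filter_upwards [hs] with p hp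
    obtain ⟨a, ω⟩ := p
    simp only [Function.comp, hF, hG]
    rw [(M.summable_extBlackoutCost μ hp s).tsum_eq_zero_add]
    simp only [extBlackoutCost_consSeq_zero, extBlackoutCost_consSeq_succ]
    rw [tsum_mul_left, mul_add]
  have hiG : Integrable G (((expMeasure M.Q).prod M.ν).prod M.shockLaw) :=
    (mp.integrable_comp_of_integrable hi).congr hFG
  have hin : ∀ a : ℝ × ℝ, ∫ ω, G (a, ω) ∂M.shockLaw =
      Real.exp (-M.θ * a.1) * M.extJumpCost μ (M.refill s a.1) a.2 := by
    intro a
    simp only [hG]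
    rw [integral_const_mul, integral_add (integrable_const _)
      (M.integrable_tsum_extBlackoutCost hμ _), integral_const, probReal_univ, one_smul]
    rfl
  have hi2 := hiG.integral_prod_left
  simp only [hin] at hi2
  calc M.extCost μ s = ∫ ω, F ω ∂M.shockLaw := rfl
    _ = ∫ p, F (consSeq p) ∂(((expMeasure M.Q).prod M.ν).prod M.shockLaw) := by
      have h := integral_map (f := F) mp.aemeasurable
        (by rw [mp.map_eq]; exact hi.aestronglyMeasurable)
      rwa [mp.map_eq] at h
    _ = ∫ p, G p ∂(((expMeasure M.Q).prod M.ν).prod M.shockLaw) := integral_congr_ae hFG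
    _ = ∫ a, Real.exp (-M.θ * a.1) * M.extJumpCost μ (M.refill s a.1) a.2
          ∂((expMeasure M.Q).prod M.ν) := by
      rw [integral_prod _ hiG]; simp only [hin]
    _ = ∫ h, Real.exp (-M.θ * h) * M.meanJumpCost μ (M.refill s h) ∂(expMeasure M.Q) := by
      rw [integral_prod _ hi2]; simp only [integral_const_mul]; rfl
    _ = _ := M.integral_expMeasure_discounted _ s

theorem ae_shockLaw_mem : ∀ᵐ ω ∂M.shockLaw, ∀ k, 0 ≤ (ω k).1 ∧ (ω k).2 ∈ Icc 0 M.B := by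
  rw [ae_all_iff]
  intro k
  have h : ∀ᵐ a ∂((expMeasure M.Q).prod M.ν), 0 ≤ a.1 ∧ a.2 ∈ Icc 0 M.B :=
    (Measure.quasiMeasurePreserving_fst.ae M.ae_expMeasure_nonneg).and
      (Measure.quasiMeasurePreserving_snd.ae M.support)
  exact (measurePreserving_eval_infinitePi (fun _ : ℕ =>
    (expMeasure M.Q).prod M.ν) k).quasiMeasurePreserving.ae h

variable {M}

theorem IsPolicy.sub_mem (hμ : M.IsPolicy μ) {s w : ℝ} (hs : s ∈ Icc 0 M.sbar)
    (hw : w ∈ Icc 0 M.B) : s - μ s w ∈ Icc 0 M.sbar := by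
  have h := hμ.feasible s hs w hw
  have h' := h.2.trans (min_le_left _ _)
  exact ⟨by linarith, by linarith [h.1, hs.2]⟩

theorem IsPolicy.shock_sub_mem (hμ : M.IsPolicy μ) {s w : ℝ} (hs : s ∈ Icc 0 M.sbar)
    (hw : w ∈ Icc 0 M.B) : w - μ s w ∈ Icc 0 M.B := by
  have h := hμ.feasible s hs w hw
  have h' := h.2.trans (min_le_right _ _)
  exact ⟨by linarith, by linarith [h.1, hw.2]⟩

theorem IsPolicy.levelBefore_mem (hμ : M.IsPolicy μ) {s : ℝ} (hs : s ∈ Icc 0 M.sbar)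
    {ω : ℕ → ℝ × ℝ} (hω : ∀ k, 0 ≤ (ω k).1 ∧ (ω k).2 ∈ Icc 0 M.B) (k : ℕ) :
    M.levelBefore μ s ω k ∈ Icc 0 M.sbar := by
  induction k with
  | zero => exact M.refill_mem hs (hω 0).1
  | succ k ih => exact M.refill_mem (hμ.sub_mem ih (hω k).2) (hω (k + 1)).1

theorem IsPolicy.blackoutCost_eq (hμ : M.IsPolicy μ) {s : ℝ} (hs : s ∈ Icc 0 M.sbar)
    {ω : ℕ → ℝ × ℝ} (hω : ∀ k, 0 ≤ (ω k).1 ∧ (ω k).2 ∈ Icc 0 M.B) :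
    M.blackoutCost μ s ω = M.extBlackoutCost μ s ω := by
  funext k
  rw [blackoutCost, extBlackoutCost,
    M.gExt_eq (hμ.shock_sub_mem (hμ.levelBefore_mem hs hω k) (hω k).2)]

theorem IsPolicy.ae_blackoutCost_eq (hμ : M.IsPolicy μ) {s : ℝ} (hs : s ∈ Icc 0 M.sbar) :
    ∀ᵐ ω ∂M.shockLaw, M.blackoutCost μ s ω = M.extBlackoutCost μ s ω :=
  M.ae_shockLaw_mem.mono fun _ hω => hμ.blackoutCost_eq hs hω

theorem IsPolicy.ae_summable_blackoutCost (hμ : M.IsPolicy μ) {s : ℝ} (hs : s ∈ Icc 0 M.sbar) :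
    ∀ᵐ ω ∂M.shockLaw, Summable (M.blackoutCost μ s ω) := by
  filter_upwards [hμ.ae_blackoutCost_eq hs, M.ae_totalDiscount_lt_top] with ω h1 h2
  rw [h1]
  exact M.summable_extBlackoutCost μ h2 s

theorem IsPolicy.integrable_tsum_blackoutCost (hμ : M.IsPolicy μ) {s : ℝ}
    (hs : s ∈ Icc 0 M.sbar) : Integrable (fun ω => ∑' k, M.blackoutCost μ s ω k) M.shockLaw :=
  (M.integrable_tsum_extBlackoutCost hμ.measurable s).congr
    ((hμ.ae_blackoutCost_eq hs).mono fun ω h => by simp only [h])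

theorem IsPolicy.policyCost_eq (hμ : M.IsPolicy μ) {s : ℝ} (hs : s ∈ Icc 0 M.sbar) :
    M.policyCost μ s = M.extCost μ s :=
  integral_congr_ae ((hμ.ae_blackoutCost_eq hs).mono fun ω h => by simp only [h])

theorem IsPolicy.jumpCost_eq (hμ : M.IsPolicy μ) {s w : ℝ} (hs : s ∈ Icc 0 M.sbar)
    (hw : w ∈ Icc 0 M.B) : M.jumpCost μ s w = M.extJumpCost μ s w := by
  rw [jumpCost, extJumpCost, M.gExt_eq (hμ.shock_sub_mem hs hw),
    hμ.policyCost_eq (hμ.sub_mem hs hw)]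

theorem IsPolicy.ae_jumpCost_eq (hμ : M.IsPolicy μ) {s : ℝ} (hs : s ∈ Icc 0 M.sbar) :
    ∀ᵐ w ∂M.ν, M.jumpCost μ s w = M.extJumpCost μ s w :=
  M.support.mono fun _ hw => hμ.jumpCost_eq hs hw

theorem IsPolicy.integral_jumpCost (hμ : M.IsPolicy μ) {s : ℝ} (hs : s ∈ Icc 0 M.sbar) :
    ∫ w, M.jumpCost μ s w ∂M.ν = M.meanJumpCost μ s :=
  integral_congr_ae (hμ.ae_jumpCost_eq hs)

theorem IsPolicy.integrable_jumpCost (hμ : M.IsPolicy μ) {s : ℝ} (hs : s ∈ Icc 0 M.sbar) :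
    Integrable (fun w => M.jumpCost μ s w) M.ν :=
  (M.integrable_extJumpCost hμ.measurable s).congr
    ((hμ.ae_jumpCost_eq hs).mono fun _ h => h.symm)

theorem IsPolicy.policyCost_eq_discounted (hμ : M.IsPolicy μ) {s : ℝ} (hs : s ∈ Icc 0 M.sbar) :
    M.policyCost μ s = M.discounted (M.meanJumpCost μ) s :=
  (hμ.policyCost_eq hs).trans (M.extCost_eq hμ.measurable s)

end

end StorageModel

/-! ### The Bellman operator and its fixed point -/

namespace StorageModel

noncomputable section

open Filter Topology BoundedContinuousFunction

/-- Cost of withdrawing the share `p` of the largest feasible withdrawal, if `V` is the cost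
incurred from the next level on. -/
def shareCost (M : StorageModel) (V : ℝ → ℝ) (x w p : ℝ) : ℝ :=
  M.gExt (w - p * min x w) + V (x - p * min x w)

/-- Least cost of a withdrawal, if `V` is the cost incurred from the next level on. -/
def bellmanMin (M : StorageModel) (V : ℝ → ℝ) (x w : ℝ) : ℝ :=
  sInf (M.shareCost V x w '' Icc 0 1)

/-- Expectation of `bellmanMin` over the shock size. -/
def bellmanMean (M : StorageModel) (V : ℝ → ℝ) (x : ℝ) : ℝ := ∫ w, M.bellmanMin V x w ∂M.ν

variable {M : StorageModel} {V V₁ V₂ : ℝ → ℝ} {C : ℝ}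

theorem continuous_shareCost (hV : Continuous V) :
    Continuous fun q : (ℝ × ℝ) × ℝ => M.shareCost V q.1.1 q.1.2 q.2 := by
  have := M.continuous_gExt
  unfold shareCost
  fun_prop

theorem continuous_shareCost_right (hV : Continuous V) (x w : ℝ) :
    Continuous (M.shareCost V x w) :=
  (continuous_shareCost hV).comp (by fun_prop : Continuous fun p : ℝ => ((x, w), p))

/-- Measuring withdrawals as shares in [0, 1] makes the constraint set independent of the level and
the shock; a minimum over a fixed compact set is continuous in its parameters. -/
theorem continuous_bellmanMin (hV : Continuous V) :
    Continuous fun q : ℝ × ℝ => M.bellmanMin V q.1 q.2 :=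
  isCompact_Icc.continuous_sInf (f := fun (q : ℝ × ℝ) p => M.shareCost V q.1 q.2 p)
    (continuous_shareCost hV)

theorem exists_bellmanMin_eq (hV : Continuous V) (x w : ℝ) :
    ∃ p ∈ Icc (0 : ℝ) 1, M.bellmanMin V x w = M.shareCost V x w p := by
  obtain ⟨p, hp, h, -⟩ := isCompact_Icc.exists_sInf_image_eq_and_le
    (nonempty_Icc.2 (zero_le_one (α := ℝ))) (continuous_shareCost_right (M := M) hV x w).continuousOn
  exact ⟨p, hp, h⟩

theorem bellmanMin_le (hV : Continuous V) (x w : ℝ) {p : ℝ} (hp : p ∈ Icc (0 : ℝ) 1) :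
    M.bellmanMin V x w ≤ M.shareCost V x w p :=
  csInf_le (isCompact_Icc.bddBelow_image (continuous_shareCost_right hV x w).continuousOn)
    (mem_image_of_mem _ hp)

theorem bellmanMin_le_of_feasible (hV : Continuous V) {x w u : ℝ} (hu : u ∈ Icc 0 (min x w)) :
    M.bellmanMin V x w ≤ M.gExt (w - u) + V (x - u) := by
  rcases (hu.1.trans hu.2).eq_or_lt with h0 | h0
  · have hu0 : u = 0 := le_antisymm (h0 ▸ hu.2) hu.1
    have h := bellmanMin_le (M := M) hV x w (p := 0) ⟨le_rfl, zero_le_one⟩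
    simpa [shareCost, hu0] using h
  · have h := bellmanMin_le (M := M) hV x w (p := u / min x w)
      ⟨div_nonneg hu.1 h0.le, (div_le_one h0).2 hu.2⟩
    rwa [shareCost, div_mul_cancel₀ _ h0.ne'] at h

theorem share_mem {x w p : ℝ} (hx : 0 ≤ x) (hw : 0 ≤ w) (hp : p ∈ Icc (0 : ℝ) 1) :
    p * min x w ∈ Icc 0 (min x w) :=
  ⟨mul_nonneg hp.1 (le_min hx hw), mul_le_of_le_one_left (le_min hx hw) hp.2⟩

theorem exists_feasible_bellmanMin_eq (hV : Continuous V) {x w : ℝ} (hx : 0 ≤ x) (hw : 0 ≤ w) :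
    ∃ u ∈ Icc 0 (min x w), M.bellmanMin V x w = M.gExt (w - u) + V (x - u) := by
  obtain ⟨p, hp, h⟩ := exists_bellmanMin_eq (M := M) hV x w
  exact ⟨p * min x w, share_mem hx hw hp, h⟩

theorem abs_bellmanMin_le (hV : Continuous V) (hC : ∀ x, |V x| ≤ C) (x w : ℝ) :
    |M.bellmanMin V x w| ≤ M.g M.B + C := by
  obtain ⟨p, hp, h⟩ := exists_bellmanMin_eq (M := M) hV x w
  rw [h]
  exact (abs_add_le _ _).trans (add_le_add (M.abs_gExt_le _) (hC _))

theorem integrable_bellmanMin (hV : Continuous V) (hC : ∀ x, |V x| ≤ C) (x : ℝ) :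
    Integrable (M.bellmanMin V x) M.ν :=
  Integrable.of_bound
    ((continuous_bellmanMin hV).measurable.comp measurable_prodMk_left).aestronglyMeasurable _
    (Eventually.of_forall (abs_bellmanMin_le hV hC x))

theorem continuous_bellmanMean (hV : Continuous V) (hC : ∀ x, |V x| ≤ C) :
    Continuous (M.bellmanMean V) :=
  continuous_of_dominated (fun x => (integrable_bellmanMin hV hC x).aestronglyMeasurable)
    (fun x => Eventually.of_forall (abs_bellmanMin_le hV hC x)) (integrable_const _)
    (Eventually.of_forall fun w =>
      (continuous_bellmanMin hV).comp (by fun_prop : Continuous fun x : ℝ => (x, w)))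

theorem abs_bellmanMean_le (hV : Continuous V) (hC : ∀ x, |V x| ≤ C) (x : ℝ) :
    |M.bellmanMean V x| ≤ M.g M.B + C := by
  have h := norm_integral_le_of_norm_le_const (μ := M.ν) (f := M.bellmanMin V x)
    (Eventually.of_forall (abs_bellmanMin_le hV hC x))
  rwa [probReal_univ, mul_one] at h

theorem bellmanMin_le_add (h₁ : Continuous V₁) (h₂ : Continuous V₂) {d : ℝ}
    (hd : ∀ x, V₁ x ≤ V₂ x + d) (x w : ℝ) : M.bellmanMin V₁ x w ≤ M.bellmanMin V₂ x w + d := by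
  obtain ⟨p, hp, h⟩ := exists_bellmanMin_eq (M := M) h₂ x w
  have := bellmanMin_le (M := M) h₁ x w hp
  rw [h]
  unfold shareCost at *
  linarith [hd (x - p * min x w)]

theorem abs_bellmanMean_sub_le {C₁ C₂ d : ℝ} (h₁ : Continuous V₁) (h₂ : Continuous V₂)
    (hC₁ : ∀ x, |V₁ x| ≤ C₁) (hC₂ : ∀ x, |V₂ x| ≤ C₂) (hd : ∀ x, |V₁ x - V₂ x| ≤ d) (x : ℝ) :
    |M.bellmanMean V₁ x - M.bellmanMean V₂ x| ≤ d := by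
  rw [bellmanMean, bellmanMean, ← integral_sub (integrable_bellmanMin h₁ hC₁ x)
    (integrable_bellmanMin h₂ hC₂ x)]
  have h := norm_integral_le_of_norm_le_const (μ := M.ν) (C := d)
    (f := fun w => M.bellmanMin V₁ x w - M.bellmanMin V₂ x w) (Eventually.of_forall fun w => by
      rw [Real.norm_eq_abs, abs_le]
      have e1 := bellmanMin_le_add (M := M) h₁ h₂ (d := d)
        (fun x => by linarith [(abs_le.1 (hd x)).2]) x w
      have e2 := bellmanMin_le_add (M := M) h₂ h₁ (d := d)
        (fun x => by linarith [(abs_le.1 (hd x)).1]) x w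
      constructor <;> linarith)
  rwa [probReal_univ, mul_one] at h

theorem discounted_sub {Φ₁ Φ₂ : ℝ → ℝ} {C₁ C₂ : ℝ} (hm₁ : Measurable Φ₁) (hm₂ : Measurable Φ₂)
    (hC₁ : ∀ x, |Φ₁ x| ≤ C₁) (hC₂ : ∀ x, |Φ₂ x| ≤ C₂) (s : ℝ) :
    M.discounted Φ₁ s - M.discounted Φ₂ s = M.discounted (fun x => Φ₁ x - Φ₂ x) s := by
  rw [discounted, discounted, discounted, ← integral_sub (integrableOn_discounted hm₁ hC₁ s)
    (integrableOn_discounted hm₂ hC₂ s)]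
  simp only [mul_sub]

theorem abs_apply_le (V : ℝ →ᵇ ℝ) (x : ℝ) : |V x| ≤ ‖V‖ := V.norm_coe_le_norm x

variable (M)

/-- The Bellman operator of the storage problem. -/
def bellman (V : ℝ →ᵇ ℝ) : ℝ →ᵇ ℝ :=
  BoundedContinuousFunction.ofNormedAddCommGroup (M.discounted (M.bellmanMean V))
    (continuous_discounted (continuous_bellmanMean V.continuous (abs_apply_le V))
      (abs_bellmanMean_le V.continuous (abs_apply_le V)))
    (M.discount * (M.g M.B + ‖V‖))
    (abs_discounted_le (abs_bellmanMean_le V.continuous (abs_apply_le V)))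

theorem bellman_apply (V : ℝ →ᵇ ℝ) (s : ℝ) :
    M.bellman V s = M.discounted (M.bellmanMean V) s := rfl

/-- Minimization and expectation over the shock do not increase the sup distance, and discounting
multiplies it by Q/(Q+θ). -/
theorem contractingWith_bellman : ContractingWith M.discount.toNNReal M.bellman := by
  refine ⟨Real.toNNReal_lt_one.2 M.discount_lt_one, LipschitzWith.of_dist_le_mul fun V₁ V₂ => ?_⟩
  rw [Real.coe_toNNReal _ M.discount_pos.le,
    BoundedContinuousFunction.dist_le (mul_nonneg M.discount_pos.le dist_nonneg)]
  intro s
  have c₁ := continuous_bellmanMean (M := M) V₁.continuous (abs_apply_le V₁)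
  have c₂ := continuous_bellmanMean (M := M) V₂.continuous (abs_apply_le V₂)
  rw [Real.dist_eq, bellman_apply, bellman_apply, discounted_sub c₁.measurable c₂.measurable
    (abs_bellmanMean_le V₁.continuous (abs_apply_le V₁))
    (abs_bellmanMean_le V₂.continuous (abs_apply_le V₂))]
  exact abs_discounted_le (abs_bellmanMean_sub_le V₁.continuous V₂.continuous (abs_apply_le V₁)
    (abs_apply_le V₂) fun x => by
      rw [← Real.dist_eq]; exact BoundedContinuousFunction.dist_coe_le_dist x) s

/-- The solution of the Bellman equation. -/
def value : ℝ →ᵇ ℝ := ContractingWith.fixedPoint M.bellman M.contractingWith_bellman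

theorem value_eq (s : ℝ) : M.value s = M.discounted (M.bellmanMean M.value) s := by
  have h : M.bellman M.value = M.value := M.contractingWith_bellman.fixedPoint_isFixedPt
  rw [← bellman_apply, h]

/-- A property which holds for `0`, is preserved by the Bellman operator and closed under pointwise
limits holds for the solution of the Bellman equation. -/
theorem value_induction {P : (ℝ → ℝ) → Prop} (h0 : P 0)
    (hT : ∀ V : ℝ →ᵇ ℝ, P V → P (M.bellman V)) (hP : IsClosed {f | P f}) : P M.value := by
  have ht := M.contractingWith_bellman.tendsto_iterate_fixedPoint 0
  have ht' : Tendsto (fun n => ((M.bellman^[n] 0 : ℝ →ᵇ ℝ) : ℝ → ℝ)) atTop (𝓝 M.value) :=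
    tendsto_pi_nhds.2 fun x =>
      ((continuous_eval_const (F := ℝ →ᵇ ℝ) x).tendsto _).comp ht
  refine hP.mem_of_tendsto ht' (Eventually.of_forall fun n => ?_)
  induction n with
  | zero => exact h0
  | succ n ih => rw [Function.iterate_succ_apply']; exact hT _ ih

variable {M}

/-! ### Monotonicity and convexity of the value -/

theorem refill_mono {s s' : ℝ} (h : s ≤ s') (t : ℝ) : M.refill s t ≤ M.refill s' t :=
  min_le_min (by linarith) le_rfl

/-- A withdrawal that is optimal at the lower level is feasible at the higher one, where it leaves
the same blackout and more energy. -/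
theorem bellmanMin_anti (hV : Continuous V) (ha : AntitoneOn V (Icc 0 M.sbar)) {x x' w : ℝ}
    (hx : x ∈ Icc 0 M.sbar) (hx' : x' ∈ Icc 0 M.sbar) (hw : 0 ≤ w) (h : x ≤ x') :
    M.bellmanMin V x' w ≤ M.bellmanMin V x w := by
  obtain ⟨u, hu, e⟩ := exists_feasible_bellmanMin_eq (M := M) hV hx.1 hw
  have hux := hu.2.trans (min_le_left _ _)
  rw [e]
  refine (bellmanMin_le_of_feasible hV ⟨hu.1, hu.2.trans (min_le_min h le_rfl)⟩).trans ?_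
  gcongr
  exact ha ⟨by linarith, by linarith [hx.2, hu.1]⟩ ⟨by linarith, by linarith [hx'.2, hu.1]⟩
    (by linarith)

theorem antitoneOn_bellmanMean (hV : Continuous V) (hC : ∀ x, |V x| ≤ C)
    (ha : AntitoneOn V (Icc 0 M.sbar)) : AntitoneOn (M.bellmanMean V) (Icc 0 M.sbar) := by
  intro x hx x' hx' h
  refine integral_mono_ae (integrable_bellmanMin hV hC x') (integrable_bellmanMin hV hC x) ?_
  filter_upwards [M.support] with w hw
  exact bellmanMin_anti hV ha hx hx' hw.1 h

theorem weight_nonneg (t : ℝ) : 0 ≤ M.Q * Real.exp (-(M.Q + M.θ) * t) :=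
  mul_nonneg M.Q_pos.le (Real.exp_pos _).le

theorem antitoneOn_discounted {Φ : ℝ → ℝ} (hm : Measurable Φ) (hC : ∀ x, |Φ x| ≤ C)
    (ha : AntitoneOn Φ (Icc 0 M.sbar)) : AntitoneOn (M.discounted Φ) (Icc 0 M.sbar) := by
  intro s hs s' hs' h
  refine setIntegral_mono_on (integrableOn_discounted hm hC s') (integrableOn_discounted hm hC s)
    measurableSet_Ioi fun t ht => mul_le_mul_of_nonneg_left ?_ (weight_nonneg t)
  exact ha (M.refill_mem hs (le_of_lt ht)) (M.refill_mem hs' (le_of_lt ht)) (refill_mono h t)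

theorem isClosed_antitoneOn (S : Set ℝ) : IsClosed {f : ℝ → ℝ | AntitoneOn f S} := by
  simp only [AntitoneOn, ofPred_forall]
  refine isClosed_iInter fun a => isClosed_iInter fun _ => isClosed_iInter fun b =>
    isClosed_iInter fun _ => isClosed_iInter fun _ => ?_
  exact isClosed_le (continuous_apply b) (continuous_apply a)

theorem isClosed_convexOn {S : Set ℝ} (hS : Convex ℝ S) : IsClosed {f : ℝ → ℝ | ConvexOn ℝ S f} := by
  simp only [ConvexOn, hS, true_and, ofPred_forall]
  refine isClosed_iInter fun x => isClosed_iInter fun _ => isClosed_iInter fun y =>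
    isClosed_iInter fun _ => isClosed_iInter fun a => isClosed_iInter fun b =>
    isClosed_iInter fun _ => isClosed_iInter fun _ => isClosed_iInter fun _ => ?_
  exact isClosed_le (continuous_apply _) (by fun_prop)

theorem antitoneOn_bellman {V : ℝ →ᵇ ℝ} (ha : AntitoneOn V (Icc 0 M.sbar)) :
    AntitoneOn (M.bellman V) (Icc 0 M.sbar) :=
  antitoneOn_discounted (continuous_bellmanMean V.continuous (abs_apply_le V)).measurable
    (abs_bellmanMean_le V.continuous (abs_apply_le V))
    (antitoneOn_bellmanMean V.continuous (abs_apply_le V) ha)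

theorem antitoneOn_value : AntitoneOn M.value (Icc 0 M.sbar) :=
  M.value_induction (P := fun f => AntitoneOn f (Icc 0 M.sbar)) (fun _ _ _ _ _ => le_rfl)
    (fun _ => antitoneOn_bellman) (isClosed_antitoneOn _)

/-- The constraint 0 ≤ u ≤ min(x, w) is jointly convex in (x, u), so mixing the optimal withdrawals
at two levels is feasible at the mixed level. -/
theorem convexOn_bellmanMin (hg : ConvexOn ℝ (Icc 0 M.B) M.g) (hV : Continuous V)
    (hc : ConvexOn ℝ (Icc 0 M.sbar) V) {w : ℝ} (hw : w ∈ Icc 0 M.B) :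
    ConvexOn ℝ (Icc 0 M.sbar) fun x => M.bellmanMin V x w := by
  have hg' : ConvexOn ℝ (Icc 0 M.B) M.gExt := hg.congr fun x hx => (M.gExt_eq hx).symm
  refine ⟨convex_Icc _ _, fun x hx y hy a b ha hb hab => ?_⟩
  obtain ⟨u, hu, eu⟩ := exists_feasible_bellmanMin_eq (M := M) hV hx.1 hw.1
  obtain ⟨v, hv, ev⟩ := exists_feasible_bellmanMin_eq (M := M) hV hy.1 hw.1
  have hux := hu.2.trans (min_le_left _ _)
  have huw := hu.2.trans (min_le_right _ _)
  have hvy := hv.2.trans (min_le_left _ _)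
  have hvw := hv.2.trans (min_le_right _ _)
  simp only [smul_eq_mul]
  have hb1 : a * w + b * w = w := by rw [← add_mul, hab, one_mul]
  have hf : a * u + b * v ∈ Icc 0 (min (a * x + b * y) w) := by
    refine ⟨add_nonneg (mul_nonneg ha hu.1) (mul_nonneg hb hv.1), le_min ?_ ?_⟩
    · exact add_le_add (mul_le_mul_of_nonneg_left hux ha) (mul_le_mul_of_nonneg_left hvy hb)
    · rw [← hb1]
      exact add_le_add (mul_le_mul_of_nonneg_left huw ha) (mul_le_mul_of_nonneg_left hvw hb)
  have h1 := hg'.2 (x := w - u) ⟨by linarith, by linarith [hu.1, hw.2]⟩ (y := w - v)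
    ⟨by linarith, by linarith [hv.1, hw.2]⟩ ha hb hab
  have h2 := hc.2 (x := x - u) ⟨by linarith, by linarith [hu.1, hx.2]⟩ (y := y - v)
    ⟨by linarith, by linarith [hv.1, hy.2]⟩ ha hb hab
  have e1 : a • (w - u) + b • (w - v) = w - (a * u + b * v) := by
    simp only [smul_eq_mul]; linear_combination hb1
  have e2 : a • (x - u) + b • (y - v) = a * x + b * y - (a * u + b * v) := by
    simp only [smul_eq_mul]; ring
  rw [e1] at h1
  rw [e2] at h2
  simp only [smul_eq_mul] at h1 h2
  rw [eu, ev]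
  refine (bellmanMin_le_of_feasible hV hf).trans ?_
  linarith

theorem convexOn_bellmanMean (hg : ConvexOn ℝ (Icc 0 M.B) M.g) (hV : Continuous V)
    (hC : ∀ x, |V x| ≤ C) (hc : ConvexOn ℝ (Icc 0 M.sbar) V) :
    ConvexOn ℝ (Icc 0 M.sbar) (M.bellmanMean V) := by
  refine ⟨convex_Icc _ _, fun x hx y hy a b ha hb hab => ?_⟩
  simp only [smul_eq_mul, bellmanMean]
  have hi := fun x => integrable_bellmanMin (M := M) hV hC x
  rw [← integral_const_mul, ← integral_const_mul,
    ← integral_add ((hi x).const_mul a) ((hi y).const_mul b)]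
  refine integral_mono_ae (hi _) (((hi x).const_mul a).add ((hi y).const_mul b)) ?_
  filter_upwards [M.support] with w hw
  exact (convexOn_bellmanMin hg hV hc hw).2 hx hy ha hb hab

/-- `refill` is concave in the initial level, and a decreasing convex function of a concave one is
convex; this is where monotonicity of Φ enters. -/
theorem convexOn_discounted {Φ : ℝ → ℝ} (hm : Measurable Φ) (hC : ∀ x, |Φ x| ≤ C)
    (ha : AntitoneOn Φ (Icc 0 M.sbar)) (hc : ConvexOn ℝ (Icc 0 M.sbar) Φ) :
    ConvexOn ℝ (Icc 0 M.sbar) (M.discounted Φ) := by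
  refine ⟨convex_Icc _ _, fun x hx y hy a b hA hB hab => ?_⟩
  have hi := fun x => integrableOn_discounted (M := M) hm hC x
  simp only [smul_eq_mul]
  rw [discounted, discounted, discounted, ← integral_const_mul, ← integral_const_mul,
    ← integral_add ((hi x).const_mul a) ((hi y).const_mul b)]
  refine setIntegral_mono_on (hi _) (((hi x).const_mul a).add ((hi y).const_mul b))
    measurableSet_Ioi fun t ht => ?_
  have hx' := M.refill_mem hx (le_of_lt ht)
  have hy' := M.refill_mem hy (le_of_lt ht)
  have h1 := hc.2 hx' hy' hA hB hab
  have hmem : a * x + b * y ∈ Icc 0 M.sbar := convex_Icc _ _ hx hy hA hB hab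
  have hmem' : a * M.refill x t + b * M.refill y t ∈ Icc 0 M.sbar :=
    convex_Icc _ _ hx' hy' hA hB hab
  have h2 := ha hmem' (M.refill_mem hmem (le_of_lt ht)) (by
    refine le_min ?_ hmem'.2
    have e : a * x + b * y + M.r * t = a * (x + M.r * t) + b * (y + M.r * t) := by
      linear_combination (-(M.r * t)) * hab
    rw [e]
    exact add_le_add (mul_le_mul_of_nonneg_left (min_le_left _ _) hA)
      (mul_le_mul_of_nonneg_left (min_le_left _ _) hB))
  simp only [smul_eq_mul] at h1
  have h3 := mul_le_mul_of_nonneg_left (h2.trans h1) (weight_nonneg (M := M) t)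
  linarith

theorem convexOn_value (hg : ConvexOn ℝ (Icc 0 M.B) M.g) :
    ConvexOn ℝ (Icc 0 M.sbar) M.value := by
  -- Preservation of convexity uses monotonicity, so both are propagated together.
  refine (M.value_induction
    (P := fun f => AntitoneOn f (Icc 0 M.sbar) ∧ ConvexOn ℝ (Icc 0 M.sbar) f)
    ⟨fun _ _ _ _ _ => le_rfl, convexOn_const 0 (convex_Icc _ _)⟩ (fun V hV => ?_)
    ((isClosed_antitoneOn _).inter (isClosed_convexOn (convex_Icc _ _)))).2
  exact ⟨antitoneOn_bellman hV.1, convexOn_discounted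
    (continuous_bellmanMean V.continuous (abs_apply_le V)).measurable
    (abs_bellmanMean_le V.continuous (abs_apply_le V))
    (antitoneOn_bellmanMean V.continuous (abs_apply_le V) hV.1)
    (convexOn_bellmanMean hg V.continuous (abs_apply_le V) hV.2)⟩

/-! ### A measurable minimizing policy -/

/-- Least share of the largest feasible withdrawal that attains `bellmanMin`. -/
def minShare (M : StorageModel) (V : ℝ → ℝ) (x w : ℝ) : ℝ :=
  sInf {p | p ∈ Icc (0 : ℝ) 1 ∧ M.shareCost V x w p ≤ M.bellmanMin V x w}

/-- The least withdrawal that attains `bellmanMin`. -/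
def greedy (M : StorageModel) (V : ℝ → ℝ) (x w : ℝ) : ℝ := M.minShare V x w * min x w

theorem minShare_mem (hV : Continuous V) (x w : ℝ) : M.minShare V x w ∈ Icc (0 : ℝ) 1 ∧
    M.shareCost V x w (M.minShare V x w) ≤ M.bellmanMin V x w := by
  have hcl : IsClosed {p | p ∈ Icc (0 : ℝ) 1 ∧ M.shareCost V x w p ≤ M.bellmanMin V x w} :=
    isClosed_Icc.inter (isClosed_le (continuous_shareCost_right hV x w) continuous_const)
  refine hcl.csInf_mem ?_ ⟨0, fun p hp => hp.1.1⟩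
  obtain ⟨p, hp, h⟩ := exists_bellmanMin_eq (M := M) hV x w
  exact ⟨p, hp, h.ge⟩

/-- Choosing the least minimizer makes sublevel sets explicit: for c ≥ 0 it is at most c exactly
when the minimum over [0, min(c, 1)] is already the minimum over [0, 1]. This is a closed condition
on (x, w). -/
theorem measurable_minShare (hV : Continuous V) :
    Measurable (Function.uncurry (M.minShare V)) := by
  refine measurable_of_Iic fun c => ?_
  rcases lt_or_ge c 0 with hc | hc
  · have : Function.uncurry (M.minShare V) ⁻¹' Iic c = ∅ := by
      refine eq_empty_of_forall_notMem fun q hq => ?_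
      exact absurd ((minShare_mem (M := M) hV q.1 q.2).1.1.trans hq) (not_le.2 hc)
    rw [this]; exact MeasurableSet.empty
  · have hne : (Icc 0 (min c 1)).Nonempty := nonempty_Icc.2 (le_min hc zero_le_one)
    have : Function.uncurry (M.minShare V) ⁻¹' Iic c =
        {q : ℝ × ℝ | sInf (M.shareCost V q.1 q.2 '' Icc 0 (min c 1)) ≤ M.bellmanMin V q.1 q.2} := by
      ext q
      simp only [mem_preimage, mem_Iic, mem_ofPred_eq, Function.uncurry]
      constructor
      · intro h
        have hm := minShare_mem (M := M) hV q.1 q.2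
        exact (csInf_le (isCompact_Icc.bddBelow_image
          (continuous_shareCost_right hV q.1 q.2).continuousOn)
          (mem_image_of_mem _ ⟨hm.1.1, le_min h hm.1.2⟩)).trans hm.2
      · intro h
        obtain ⟨p, hp, e, -⟩ := isCompact_Icc.exists_sInf_image_eq_and_le hne
          (continuous_shareCost_right (M := M) hV q.1 q.2).continuousOn
        rw [e] at h
        exact (csInf_le ⟨0, fun p hp => hp.1.1⟩
          ⟨⟨hp.1, hp.2.trans (min_le_right _ _)⟩, h⟩ : M.minShare V q.1 q.2 ≤ p).trans
          (hp.2.trans (min_le_left _ _))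
    rw [this]
    exact (isClosed_le (isCompact_Icc.continuous_sInf
      (f := fun (q : ℝ × ℝ) p => M.shareCost V q.1 q.2 p) (continuous_shareCost hV))
      (continuous_bellmanMin hV)).measurableSet

theorem isPolicy_greedy (hV : Continuous V) : M.IsPolicy (M.greedy V) where
  measurable := (measurable_minShare hV).mul (by fun_prop)
  feasible _ hs _ hw := share_mem hs.1 hw.1 (minShare_mem hV _ _).1

theorem greedy_cost (hV : Continuous V) (x w : ℝ) :
    M.gExt (w - M.greedy V x w) + V (x - M.greedy V x w) = M.bellmanMin V x w :=
  le_antisymm (minShare_mem hV x w).2 (bellmanMin_le hV x w (minShare_mem hV x w).1)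

end

end StorageModel

/-! ### Verification: the fixed point is the optimal cost -/

namespace StorageModel

noncomputable section

open Filter Topology BoundedContinuousFunction

variable {M : StorageModel} {μ : ℝ → ℝ → ℝ}

/-- Comparison principle for recursively defined discounted costs. -/
theorem le_of_discounted {f₁ f₂ Φ₁ Φ₂ : ℝ → ℝ} (hm₁ : Measurable Φ₁) (hm₂ : Measurable Φ₂)
    {A C₁ C₂ : ℝ} (hC₁ : ∀ x, |Φ₁ x| ≤ C₁) (hC₂ : ∀ x, |Φ₂ x| ≤ C₂)
    (h₁ : ∀ s ∈ Icc 0 M.sbar, f₁ s = M.discounted Φ₁ s)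
    (h₂ : ∀ s ∈ Icc 0 M.sbar, f₂ s = M.discounted Φ₂ s)
    (hA : ∀ s ∈ Icc 0 M.sbar, f₁ s ≤ f₂ s + A)
    (hstep : ∀ c, (∀ s ∈ Icc 0 M.sbar, f₁ s ≤ f₂ s + c) →
      ∀ s ∈ Icc 0 M.sbar, Φ₁ s ≤ Φ₂ s + c) {s : ℝ} (hs : s ∈ Icc 0 M.sbar) : f₁ s ≤ f₂ s := by
  -- Each passage through the recursion improves the a priori gap A by the factor `discount`.
  have h : ∀ n : ℕ, ∀ s ∈ Icc 0 M.sbar, f₁ s ≤ f₂ s + M.discount ^ n * A := by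
    intro n
    induction n with
    | zero => simpa using hA
    | succ n ih =>
      intro s hs
      rw [h₁ s hs, h₂ s hs, pow_succ', mul_assoc]
      exact discounted_le hm₁ hm₂ hC₁ hC₂ hs (hstep _ ih)
  have ht : Tendsto (fun n : ℕ => f₂ s + M.discount ^ n * A) atTop (𝓝 (f₂ s + 0 * A)) :=
    ((tendsto_pow_atTop_nhds_zero_of_lt_one M.discount_pos.le M.discount_lt_one).mul_const
      A).const_add _
  rw [zero_mul, add_zero] at ht
  exact ge_of_tendsto' ht fun n => h n s hs

theorem measurable_bellmanMean_value : Measurable (M.bellmanMean M.value) :=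
  (continuous_bellmanMean M.value.continuous (abs_apply_le M.value)).measurable

theorem abs_bellmanMean_value_le (x : ℝ) : |M.bellmanMean M.value x| ≤ M.g M.B + ‖M.value‖ :=
  abs_bellmanMean_le M.value.continuous (abs_apply_le M.value) x

theorem integrable_bellmanMin_value (x : ℝ) : Integrable (M.bellmanMin M.value x) M.ν :=
  integrable_bellmanMin M.value.continuous (abs_apply_le M.value) x

theorem value_le_add (s : ℝ) : M.value s ≤ M.extCost μ s + (‖M.value‖ + M.costBound) := by
  linarith [(abs_le.1 (abs_apply_le M.value s)).2, (abs_le.1 (M.abs_extCost_le (μ := μ) s)).1]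

theorem extCost_le_add (s : ℝ) : M.extCost μ s ≤ M.value s + (‖M.value‖ + M.costBound) := by
  linarith [(abs_le.1 (abs_apply_le M.value s)).1, (abs_le.1 (M.abs_extCost_le (μ := μ) s)).2]

theorem IsPolicy.bellmanMin_le_extJumpCost (hμ : M.IsPolicy μ) {c : ℝ}
    (hc : ∀ s ∈ Icc 0 M.sbar, M.value s ≤ M.extCost μ s + c) {s w : ℝ} (hs : s ∈ Icc 0 M.sbar)
    (hw : w ∈ Icc 0 M.B) : M.bellmanMin M.value s w ≤ M.extJumpCost μ s w + c := by
  have h := bellmanMin_le_of_feasible (M := M) M.value.continuous (hμ.feasible s hs w hw)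
  have h' := hc _ (hμ.sub_mem hs hw)
  rw [extJumpCost]
  linarith

theorem IsPolicy.bellmanMean_le_meanJumpCost (hμ : M.IsPolicy μ) {c : ℝ}
    (hc : ∀ s ∈ Icc 0 M.sbar, M.value s ≤ M.extCost μ s + c) {s : ℝ} (hs : s ∈ Icc 0 M.sbar) :
    M.bellmanMean M.value s ≤ M.meanJumpCost μ s + c := by
  have hi := M.integrable_extJumpCost hμ.measurable s
  have e : M.meanJumpCost μ s + c = ∫ w, (M.extJumpCost μ s w + c) ∂M.ν := by
    rw [integral_add hi (integrable_const _), integral_const, probReal_univ, one_smul]; rfl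
  rw [e]
  refine integral_mono_ae (integrable_bellmanMin_value s) (hi.add (integrable_const _)) ?_
  filter_upwards [M.support] with w hw
  exact hμ.bellmanMin_le_extJumpCost hc hs hw

/-- No policy has a lower cost than the solution of the Bellman equation. -/
theorem IsPolicy.value_le (hμ : M.IsPolicy μ) {s : ℝ} (hs : s ∈ Icc 0 M.sbar) :
    M.value s ≤ M.extCost μ s :=
  le_of_discounted measurable_bellmanMean_value (M.measurable_meanJumpCost hμ.measurable)
    abs_bellmanMean_value_le M.abs_meanJumpCost_le (fun s _ => M.value_eq s)
    (fun s _ => M.extCost_eq hμ.measurable s) (fun s _ => value_le_add s)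
    (fun _ hc _ hs => hμ.bellmanMean_le_meanJumpCost hc hs) hs

variable (M) in
/-- The optimal policy which withdraws as little as possible. -/
def optPolicy : ℝ → ℝ → ℝ := M.greedy M.value

theorem isPolicy_optPolicy : M.IsPolicy M.optPolicy := isPolicy_greedy M.value.continuous

theorem extCost_optPolicy {s : ℝ} (hs : s ∈ Icc 0 M.sbar) :
    M.extCost M.optPolicy s = M.value s := by
  have hp := isPolicy_optPolicy (M := M)
  refine le_antisymm ?_ (hp.value_le hs)
  refine le_of_discounted (M.measurable_meanJumpCost hp.measurable) measurable_bellmanMean_value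
    M.abs_meanJumpCost_le abs_bellmanMean_value_le (fun s _ => M.extCost_eq hp.measurable s)
    (fun s _ => M.value_eq s) (fun s _ => extCost_le_add s) (fun c hc s hs => ?_) hs
  have hi := integrable_bellmanMin_value (M := M) s
  have e : M.bellmanMean M.value s + c = ∫ w, (M.bellmanMin M.value s w + c) ∂M.ν := by
    rw [integral_add hi (integrable_const _), integral_const, probReal_univ, one_smul]; rfl
  rw [e]
  refine integral_mono_ae (M.integrable_extJumpCost hp.measurable s)
    (hi.add (integrable_const _)) ?_
  filter_upwards [M.support] with w hw
  have h := hc _ (hp.sub_mem hs hw)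
  simp only [← greedy_cost (M := M) M.value.continuous s w, extJumpCost]
  change M.gExt (w - M.optPolicy s w) + _ ≤ M.gExt (w - M.optPolicy s w) +
    M.value (s - M.optPolicy s w) + c
  linarith

theorem policyCost_optPolicy {s : ℝ} (hs : s ∈ Icc 0 M.sbar) :
    M.policyCost M.optPolicy s = M.value s :=
  (isPolicy_optPolicy.policyCost_eq hs).trans (extCost_optPolicy hs)

theorem IsPolicy.value_le_policyCost (hμ : M.IsPolicy μ) {s : ℝ} (hs : s ∈ Icc 0 M.sbar) :
    M.value s ≤ M.policyCost μ s :=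
  (hμ.value_le hs).trans (hμ.policyCost_eq hs).ge

theorem isOptimal_optPolicy : M.IsOptimal M.optPolicy :=
  ⟨isPolicy_optPolicy, fun _ hs _ hμ' =>
    (policyCost_optPolicy hs).le.trans (hμ'.value_le_policyCost hs)⟩

theorem optCost_eq {s : ℝ} (hs : s ∈ Icc 0 M.sbar) : M.optCost s = M.value s := by
  refine IsLeast.csInf_eq ⟨⟨M.optPolicy, isPolicy_optPolicy, policyCost_optPolicy hs⟩, ?_⟩
  rintro c ⟨μ, hμ, rfl⟩
  exact hμ.value_le_policyCost hs

theorem feasible_cost_eq {s w u : ℝ} (hs : s ∈ Icc 0 M.sbar) (hw : w ∈ Icc 0 M.B)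
    (hu : u ∈ Icc 0 (min s w)) :
    M.g (w - u) + M.optCost (s - u) = M.gExt (w - u) + M.value (s - u) := by
  have h1 := hu.2.trans (min_le_left _ _)
  have h2 := hu.2.trans (min_le_right _ _)
  rw [M.gExt_eq ⟨by linarith, by linarith [hu.1, hw.2]⟩,
    optCost_eq ⟨by linarith, by linarith [hu.1, hs.2]⟩]

theorem minCost_eq {s w : ℝ} (hs : s ∈ Icc 0 M.sbar) (hw : w ∈ Icc 0 M.B) :
    M.minCost s w = M.bellmanMin M.value s w := by
  obtain ⟨u, hu, e⟩ := exists_feasible_bellmanMin_eq (M := M) M.value.continuous hs.1 hw.1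
  refine IsLeast.csInf_eq ⟨⟨u, hu, (feasible_cost_eq hs hw hu).trans e.symm⟩, ?_⟩
  rintro _ ⟨v, hv, rfl⟩
  simp only [feasible_cost_eq hs hw hv]
  exact bellmanMin_le_of_feasible M.value.continuous hv

theorem achieves_of_le {s w u : ℝ} (hs : s ∈ Icc 0 M.sbar) (hw : w ∈ Icc 0 M.B)
    (hu : u ∈ Icc 0 (min s w))
    (h : M.gExt (w - u) + M.value (s - u) ≤ M.bellmanMin M.value s w) : M.Achieves s w u := by
  refine ⟨hu, fun v hv => ?_⟩
  simp only [mem_ofPred_eq, feasible_cost_eq hs hw hu, feasible_cost_eq hs hw hv]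
  exact h.trans (bellmanMin_le_of_feasible M.value.continuous hv)

theorem achieves_optPolicy {s w : ℝ} (hs : s ∈ Icc 0 M.sbar) (hw : w ∈ Icc 0 M.B) :
    M.Achieves s w (M.optPolicy s w) :=
  achieves_of_le hs hw (isPolicy_optPolicy.feasible s hs w hw)
    (greedy_cost M.value.continuous s w).le

/-- Continuing with `value` costs no more than continuing with μ, so the withdrawal of μ attains the
minimum as soon as its own jump cost does. -/
theorem IsPolicy.achieves_of_extJumpCost_le (hμ : M.IsPolicy μ) {s w : ℝ}
    (hs : s ∈ Icc 0 M.sbar) (hw : w ∈ Icc 0 M.B)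
    (h : M.extJumpCost μ s w ≤ M.bellmanMin M.value s w) : M.Achieves s w (μ s w) := by
  refine achieves_of_le hs hw (hμ.feasible s hs w hw) (le_trans ?_ h)
  rw [extJumpCost]
  linarith [hμ.value_le (hμ.sub_mem hs hw)]

theorem IsPolicy.achieves_of_forall_jumpCost_le (hμ : M.IsPolicy μ) {s w : ℝ}
    (hs : s ∈ Icc 0 M.sbar) (hw : w ∈ Icc 0 M.B)
    (h : ∀ μ', M.IsPolicy μ' → M.jumpCost μ s w ≤ M.jumpCost μ' s w) :
    M.Achieves s w (μ s w) := by
  have hp := isPolicy_optPolicy (M := M)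
  refine hμ.achieves_of_extJumpCost_le hs hw ?_
  rw [← hμ.jumpCost_eq hs hw]
  refine (h _ hp).trans ?_
  rw [hp.jumpCost_eq hs hw, extJumpCost, extCost_optPolicy (hp.sub_mem hs hw)]
  exact (greedy_cost M.value.continuous s w).le

theorem IsPolicy.ae_achieves_of_meanJumpCost_eq (hμ : M.IsPolicy μ) {s : ℝ}
    (hs : s ∈ Icc 0 M.sbar) (h : M.meanJumpCost μ s = M.bellmanMean M.value s) :
    ∀ᵐ w ∂M.ν, M.Achieves s w (μ s w) := by
  have hle : M.bellmanMin M.value s ≤ᵐ[M.ν] M.extJumpCost μ s := by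
    filter_upwards [M.support] with w hw
    simpa using hμ.bellmanMin_le_extJumpCost (c := 0)
      (fun s hs => by simpa using hμ.value_le hs) hs hw
  have heq := (integral_eq_iff_of_ae_le (integrable_bellmanMin_value s)
    (M.integrable_extJumpCost hμ.measurable s) hle).1 h.symm
  filter_upwards [heq, M.support] with w h1 hw
  exact hμ.achieves_of_extJumpCost_le hs hw h1.ge

/-! ### Derivative of the value, and what optimal policies minimize -/

theorem hasDerivWithinAt_value {s : ℝ} (hs : s ∈ Icc 0 M.sbar) :
    HasDerivWithinAt (M.discounted (M.bellmanMean M.value))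
      ((M.Q + M.θ) / M.r * M.discounted (M.bellmanMean M.value) s -
        M.Q / M.r * M.bellmanMean M.value s) (Icc 0 M.sbar) s :=
  hasDerivWithinAt_discounted measurable_bellmanMean_value abs_bellmanMean_value_le hs
    (continuous_bellmanMean M.value.continuous (abs_apply_le M.value)).continuousWithinAt

/-- A full storage stays full until the next shock, so discounting there is multiplication by
Q/(Q+θ) and the two terms cancel. -/
theorem deriv_sbar_eq_zero (Φ : ℝ → ℝ) :
    (M.Q + M.θ) / M.r * M.discounted Φ M.sbar - M.Q / M.r * Φ M.sbar = 0 := by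
  have := M.rate_pos.ne'
  have := M.r_pos.ne'
  rw [discounted_sbar, discount]
  field_simp
  ring

theorem IsOptimal.discounted_eq (hμ : M.IsOptimal μ) {s : ℝ} (hs : s ∈ Icc 0 M.sbar) :
    M.discounted (M.meanJumpCost μ) s = M.discounted (M.bellmanMean M.value) s := by
  rw [← M.value_eq, ← hμ.1.policyCost_eq_discounted hs]
  exact le_antisymm ((hμ.2 s hs _ isPolicy_optPolicy).trans (policyCost_optPolicy hs).le)
    (hμ.1.value_le_policyCost hs)

theorem IsOptimal.ae_achieves (hμ : M.IsOptimal μ) :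
    ∀ᵐ s ∂(volume.restrict (Icc 0 M.sbar)), ∀ᵐ w ∂M.ν, M.Achieves s w (μ s w) := by
  filter_upwards [ae_hasDerivWithinAt_discounted (M.measurable_meanJumpCost hμ.1.measurable)
    M.abs_meanJumpCost_le, ae_restrict_mem measurableSet_Icc] with s h hs
  refine hμ.1.ae_achieves_of_meanJumpCost_eq hs ?_
  -- Both discounted means agree on the whole interval, hence so do their derivatives; the cost
  -- terms cancel and the two means at s remain.
  have h2 := (hasDerivWithinAt_value hs).congr (fun x hx => hμ.discounted_eq hx)
    (hμ.discounted_eq hs)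
  have h3 := (uniqueDiffOn_Icc M.sbar_pos s hs).eq_deriv _ h h2
  rw [hμ.discounted_eq hs, sub_right_inj] at h3
  exact mul_left_cancel₀ (div_pos M.Q_pos M.r_pos).ne' h3

/-- The full level alone is a Lebesgue null set, but discounting from it depends on the mean at that
level only, so equal costs give equal means. -/
theorem IsOptimal.ae_achieves_sbar (hμ : M.IsOptimal μ) :
    ∀ᵐ w ∂M.ν, M.Achieves M.sbar w (μ M.sbar w) := by
  refine hμ.1.ae_achieves_of_meanJumpCost_eq M.sbar_mem ?_
  have h := hμ.discounted_eq M.sbar_mem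
  rw [discounted_sbar, discounted_sbar] at h
  exact mul_left_cancel₀ M.discount_pos.ne' h

/-! ### Strict monotonicity of the value -/

/-- Ordered integrands with equal integrals agree almost everywhere, and by continuity at all times,
including t = 0. -/
theorem eqOn_refill_of_discounted_eq {Φ : ℝ → ℝ} {C : ℝ} (hc : Continuous Φ)
    (hC : ∀ x, |Φ x| ≤ C) (ha : AntitoneOn Φ (Icc 0 M.sbar)) {s s' : ℝ} (hs : s ∈ Icc 0 M.sbar)
    (hs' : s' ∈ Icc 0 M.sbar) (h : s ≤ s') (he : M.discounted Φ s = M.discounted Φ s') {t : ℝ}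
    (ht : 0 ≤ t) : Φ (M.refill s t) = Φ (M.refill s' t) := by
  have hle : (fun t => M.Q * Real.exp (-(M.Q + M.θ) * t) * Φ (M.refill s' t)) ≤ᵐ[volume.restrict
      (Ioi 0)] fun t => M.Q * Real.exp (-(M.Q + M.θ) * t) * Φ (M.refill s t) := by
    filter_upwards [ae_restrict_mem measurableSet_Ioi] with t ht
    exact mul_le_mul_of_nonneg_left (ha (M.refill_mem hs (le_of_lt ht))
      (M.refill_mem hs' (le_of_lt ht)) (refill_mono h t)) (weight_nonneg t)
  have hae := (integral_eq_iff_of_ae_le (integrableOn_discounted hc.measurable hC s')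
    (integrableOn_discounted hc.measurable hC s) hle).1 he.symm
  have hcr : ∀ s, Continuous fun t => Φ (M.refill s t) := fun s =>
    hc.comp (M.continuous_refill.comp (by fun_prop : Continuous fun t : ℝ => (s, t)))
  have heq : EqOn (fun t => Φ (M.refill s t)) (fun t => Φ (M.refill s' t)) (Ioi 0) := by
    refine Measure.eqOn_open_of_ae_eq (μ := volume) ?_ isOpen_Ioi (hcr s).continuousOn
      (hcr s').continuousOn
    filter_upwards [hae] with t ht
    exact mul_left_cancel₀ (mul_pos M.Q_pos (Real.exp_pos _)).ne' ht.symm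
  have hcl := heq.closure (hcr s) (hcr s')
  rw [closure_Ioi] at hcl
  exact hcl ht

theorem discounted_eq_sbar_of_discounted_eq {Φ : ℝ → ℝ} {C : ℝ} (hc : Continuous Φ)
    (hC : ∀ x, |Φ x| ≤ C) (ha : AntitoneOn Φ (Icc 0 M.sbar)) {s s' : ℝ} (hs : s ∈ Icc 0 M.sbar)
    (hs' : s' ∈ Icc 0 M.sbar) (h : s < s') (he : M.discounted Φ s = M.discounted Φ s') :
    M.discounted Φ s = M.discounted Φ M.sbar := by
  have hr := M.r_pos
  -- Φ agrees along the refill paths from s and s', so it repeats under steps of length s' - s until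
  -- `sbar` is reached. Being monotone, it is then constant on [s, sbar].
  have hn : ∀ n : ℕ, Φ s = Φ (min (s + n * (s' - s)) M.sbar) := by
    intro n
    induction n with
    | zero => simp [hs.2]
    | succ n ih =>
      -- At this time the path from s is at the n-th point of the progression and the path from s'
      -- at the next one.
      have h1 := eqOn_refill_of_discounted_eq hc hC ha hs hs' h.le he
        (t := n * (s' - s) / M.r) (div_nonneg (mul_nonneg n.cast_nonneg (by linarith)) hr.le)
      rw [refill, refill, mul_div_cancel₀ _ hr.ne'] at h1
      rw [ih, h1]
      push_cast
      ring_nf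
  obtain ⟨n, hn'⟩ := exists_nat_ge ((M.sbar - s) / (s' - s))
  rw [div_le_iff₀ (by linarith)] at hn'
  have h2 := hn n
  rw [min_eq_right (by linarith)] at h2
  refine setIntegral_congr_fun measurableSet_Ioi fun t ht => ?_
  have h3 := M.refill_mem hs (le_of_lt ht)
  have h4 : s ≤ M.refill s t :=
    le_min (by have := mul_nonneg hr.le (le_of_lt ht); linarith) hs.2
  have h5 : M.refill M.sbar t = M.sbar :=
    min_eq_right (by have := mul_nonneg hr.le (le_of_lt ht); linarith)
  have h6 : Φ (M.refill s t) = Φ M.sbar :=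
    le_antisymm ((ha hs h3 h4).trans h2.le) (ha h3 M.sbar_mem h3.2)
  simp only [h5, h6]

/-- Since g(0) = 0 and E[g(W)] > 0, the shock is positive with positive probability. -/
theorem exists_pos_shock {p : ℝ → Prop} (hp : ∀ᵐ w ∂M.ν, p w) :
    ∃ w ∈ Icc 0 M.B, 0 < w ∧ p w := by
  by_contra! hne
  have h0 : ∀ᵐ w ∂M.ν, M.g w = 0 := by
    filter_upwards [hp, M.support] with w h1 hw
    have : w = 0 := by
      rcases hw.1.eq_or_lt with h | h
      · exact h.symm
      · exact absurd h1 (hne w hw h)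
    rw [this, M.g_zero]
  have h := M.g_mean_pos
  rw [integral_eq_zero_of_ae h0] at h
  exact lt_irrefl _ h

theorem strictAntiOn_value : StrictAntiOn M.value (Icc 0 M.sbar) := by
  have hV := M.value.continuous
  have hanti := antitoneOn_value (M := M)
  have hΦc := continuous_bellmanMean (M := M) hV (abs_apply_le M.value)
  have hΦa := antitoneOn_bellmanMean (M := M) hV (abs_apply_le M.value) hanti
  have hconst : ∀ s ∈ Icc 0 M.sbar, ∀ s' ∈ Icc 0 M.sbar, s < s' → M.value s = M.value s' →
      M.value s = M.value M.sbar := by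
    intro s hs s' hs' h he
    rw [M.value_eq, M.value_eq] at he ⊢
    exact discounted_eq_sbar_of_discounted_eq hΦc abs_bellmanMean_value_le hΦa hs hs' h he
  intro s hs s' hs' h
  refine (hanti hs hs' h.le).lt_of_ne fun he => ?_
  -- The contradiction is reached at the least element a of K, which is below `sbar`.
  set K := {x | x ∈ Icc 0 M.sbar ∧ M.value x = M.value M.sbar} with hK
  have hKc : IsClosed K := isClosed_Icc.inter (isClosed_eq hV continuous_const)
  have hKb : BddBelow K := ⟨0, fun x hx => hx.1.1⟩
  have hsK : s ∈ K := ⟨hs, hconst s hs s' hs' h he.symm⟩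
  obtain ⟨ha, hav⟩ := hKc.csInf_mem ⟨s, hsK⟩ hKb
  have has : sInf K < M.sbar := (csInf_le hKb hsK).trans_lt (h.trans_le hs'.2)
  have hmin : ∀ x ∈ K, sInf K ≤ x := fun x hx => csInf_le hKb hx
  generalize sInf K = a at ha hav has hmin
  have hΦ : M.bellmanMean M.value a = M.bellmanMean M.value M.sbar := by
    have e := eqOn_refill_of_discounted_eq (t := 0) hΦc abs_bellmanMean_value_le hΦa ha M.sbar_mem
      has.le (by rw [← M.value_eq, ← M.value_eq, hav]) le_rfl
    simpa [refill, ha.2] using e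
  have hle : M.bellmanMin M.value M.sbar ≤ᵐ[M.ν] M.bellmanMin M.value a := by
    filter_upwards [M.support] with w hw
    exact bellmanMin_anti hV hanti ha M.sbar_mem hw.1 has.le
  have hae := (integral_eq_iff_of_ae_le (integrable_bellmanMin_value M.sbar)
    (integrable_bellmanMin_value a) hle).1 hΦ.symm
  obtain ⟨w, hw, hw0, hwe⟩ := exists_pos_shock hae
  obtain ⟨u, hu, eu⟩ := exists_feasible_bellmanMin_eq (M := M) hV ha.1 hw.1
  have hua := hu.2.trans (min_le_left _ _)
  have huw := hu.2.trans (min_le_right _ _)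
  rcases huw.eq_or_lt with rfl | hlt
  -- If the shock is fully covered at a, covering it at `sbar` too shows that the value is the same
  -- at a - u and `sbar` - u. Then a - u lies in K, below its least element.
  · have h1 := bellmanMin_le_of_feasible (M := M) (x := M.sbar) (w := u) hV
      ⟨hu.1, le_min (by linarith) le_rfl⟩
    rw [hwe, eu] at h1
    have hm1 : a - u ∈ Icc 0 M.sbar := ⟨by linarith, by linarith⟩
    have hm2 : M.sbar - u ∈ Icc 0 M.sbar := ⟨by linarith, by linarith⟩
    have h2 : M.value (a - u) = M.value (M.sbar - u) :=
      le_antisymm (by linarith) (hanti hm1 hm2 (by linarith))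
    have h3 := hmin _ ⟨hm1, hconst _ hm1 _ hm2 (by linarith) h2⟩
    linarith
  -- If a blackout remains at a, the surplus `sbar` - a is spent on it: the level left is at least a
  -- - u and the blackout is strictly smaller, so the minimum at `sbar` is strictly below that at a.
  · have hv : min (u + (M.sbar - a)) w ∈ Icc 0 (min M.sbar w) :=
      ⟨le_min (by linarith [hu.1]) hw.1, min_le_min (by linarith) le_rfl⟩
    have huv : u < min (u + (M.sbar - a)) w := lt_min (by linarith) hlt
    have hvw := min_le_right (u + (M.sbar - a)) w
    have hvu := min_le_left (u + (M.sbar - a)) w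
    have hvs := hv.2.trans (min_le_left _ _)
    have h1 := bellmanMin_le_of_feasible (M := M) hV hv
    generalize min (u + (M.sbar - a)) w = v at hv huv hvw hvu hvs h1
    have h2 := hanti (a := a - u) ⟨by linarith, by linarith [hu.1]⟩ (b := M.sbar - v)
      ⟨by linarith, by linarith [hv.1]⟩ (by linarith)
    have hm1 : w - v ∈ Icc 0 M.B := ⟨by linarith, by linarith [hw.2, hv.1]⟩
    have hm2 : w - u ∈ Icc 0 M.B := ⟨by linarith, by linarith [hw.2, hu.1]⟩
    have h3 := M.g_strictMono hm1 hm2 (by linarith)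
    rw [← M.gExt_eq hm1, ← M.gExt_eq hm2] at h3
    rw [hwe, eu] at h1
    linarith

/-! ### Differential equations for the policy costs and the optimal cost -/

theorem IsPolicy.hasDerivWithinAt_policyCost (hμ : M.IsPolicy μ) {s : ℝ}
    (hs : s ∈ Icc 0 M.sbar) (h : HasDerivWithinAt (M.discounted (M.meanJumpCost μ))
      ((M.Q + M.θ) / M.r * M.discounted (M.meanJumpCost μ) s - M.Q / M.r * M.meanJumpCost μ s)
      (Icc 0 M.sbar) s) :
    HasDerivWithinAt (M.policyCost μ)
      ((M.Q + M.θ) / M.r * M.policyCost μ s - M.Q / M.r * ∫ w, M.jumpCost μ s w ∂M.ν)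
      (Icc 0 M.sbar) s := by
  rw [hμ.integral_jumpCost hs, hμ.policyCost_eq_discounted hs]
  exact h.congr (fun x hx => hμ.policyCost_eq_discounted hx) (hμ.policyCost_eq_discounted hs)

theorem IsPolicy.hasDerivWithinAt_policyCost_of_continuous (hμ : M.IsPolicy μ) {s : ℝ}
    (hs : s ∈ Icc 0 M.sbar)
    (hc : ContinuousWithinAt (fun x => ∫ w, M.jumpCost μ x w ∂M.ν) (Icc 0 M.sbar) s) :
    HasDerivWithinAt (M.policyCost μ)
      ((M.Q + M.θ) / M.r * M.policyCost μ s - M.Q / M.r * ∫ w, M.jumpCost μ s w ∂M.ν)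
      (Icc 0 M.sbar) s :=
  hμ.hasDerivWithinAt_policyCost hs
    (hasDerivWithinAt_discounted (M.measurable_meanJumpCost hμ.measurable) M.abs_meanJumpCost_le hs
      (hc.congr (fun _ hx => (hμ.integral_jumpCost hx).symm) (hμ.integral_jumpCost hs).symm))

/-- Dominated convergence: the policy cost is continuous in the level whatever the policy, so only
the continuity of the withdrawal at s matters. -/
theorem IsPolicy.continuousWithinAt_integral_jumpCost (hμ : M.IsPolicy μ) {s : ℝ}
    (hs : s ∈ Icc 0 M.sbar)
    (hc : ∀ᵐ w ∂M.ν, ContinuousWithinAt (fun x => μ x w) (Icc 0 M.sbar) s) :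
    ContinuousWithinAt (fun x => ∫ w, M.jumpCost μ x w ∂M.ν) (Icc 0 M.sbar) s := by
  have hcost : ContinuousOn (M.extCost μ) (Icc 0 M.sbar) :=
    (continuousOn_discounted (M.measurable_meanJumpCost hμ.measurable)
      M.abs_meanJumpCost_le).congr fun x _ => M.extCost_eq hμ.measurable x
  refine ContinuousWithinAt.congr (f := M.meanJumpCost μ) ?_
    (fun _ hx => hμ.integral_jumpCost hx) (hμ.integral_jumpCost hs)
  refine tendsto_integral_filter_of_dominated_convergence (fun _ => M.g M.B + M.costBound)
    (Eventually.of_forall fun x =>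
      (M.integrable_extJumpCost hμ.measurable x).aestronglyMeasurable)
    (Eventually.of_forall fun x => Eventually.of_forall (M.abs_extJumpCost_le x))
    (integrable_const _) ?_
  filter_upwards [hc, M.support] with w hcw hw
  have h1 : ContinuousWithinAt (fun x => M.gExt (w - μ x w)) (Icc 0 M.sbar) s :=
    M.continuous_gExt.continuousAt.comp_continuousWithinAt (continuousWithinAt_const.sub hcw)
  have h2 : ContinuousWithinAt (fun x => M.extCost μ (x - μ x w)) (Icc 0 M.sbar) s :=
    (hcost _ (hμ.sub_mem hs hw)).comp (f := fun x => x - μ x w) (continuousWithinAt_id.sub hcw)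
      (fun x hx => hμ.sub_mem hx hw)
  exact h1.add h2

theorem integral_minCost {s : ℝ} (hs : s ∈ Icc 0 M.sbar) :
    ∫ w, M.minCost s w ∂M.ν = M.bellmanMean M.value s :=
  integral_congr_ae (M.support.mono fun _ hw => minCost_eq hs hw)

theorem integrable_minCost {s : ℝ} (hs : s ∈ Icc 0 M.sbar) :
    Integrable (fun w => M.minCost s w) M.ν :=
  (integrable_bellmanMin_value s).congr (M.support.mono fun _ hw => (minCost_eq hs hw).symm)

/-- The value is continuous, hence so is the expected minimum, and the derivative formula applies at
every level. -/
theorem hasDerivWithinAt_optCost {s : ℝ} (hs : s ∈ Icc 0 M.sbar) :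
    HasDerivWithinAt M.optCost
      ((M.Q + M.θ) / M.r * M.optCost s - M.Q / M.r * ∫ w, M.minCost s w ∂M.ν)
      (Icc 0 M.sbar) s := by
  rw [integral_minCost hs, optCost_eq hs, M.value_eq]
  exact (hasDerivWithinAt_value hs).congr (fun x hx => (optCost_eq hx).trans (M.value_eq x))
    ((optCost_eq hs).trans (M.value_eq s))

end

end StorageModel

/-! ### Assembly of the theorem -/

theorem theorem2 (M : StorageModel) :
    -- the costs of all policies are well defined, and the optimal cost is attained
    ((∀ μ, M.IsPolicy μ → ∀ s ∈ Icc 0 M.sbar,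
        (∀ᵐ ω ∂M.shockLaw, Summable (M.blackoutCost μ s ω)) ∧
        Integrable (fun ω => ∑' k, M.blackoutCost μ s ω k) M.shockLaw) ∧
      ∃ μ, M.IsPolicy μ ∧ ∀ s ∈ Icc 0 M.sbar, M.policyCost μ s = M.optCost s) ∧
    -- (i)
    StrictAntiOn M.optCost (Icc 0 M.sbar) ∧
    -- (ii)
    (ConvexOn ℝ (Icc 0 M.B) M.g → ConvexOn ℝ (Icc 0 M.sbar) M.optCost) ∧
    -- (iii) HJB equation and boundary condition
    (ContDiffOn ℝ 1 M.optCost (Icc 0 M.sbar) →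
      (∀ s ∈ Icc 0 M.sbar,
        Integrable (fun w => M.minCost s w) M.ν ∧
        HasDerivWithinAt M.optCost
          ((M.Q + M.θ) / M.r * M.optCost s - M.Q / M.r * ∫ w, M.minCost s w ∂M.ν)
          (Icc 0 M.sbar) s) ∧
      HasDerivWithinAt M.optCost 0 (Icc 0 M.sbar) M.sbar) ∧
    -- some optimal policy achieves the minimum in the HJB equation everywhere,
    (∃ μ, M.IsOptimal μ ∧ ∀ s ∈ Icc 0 M.sbar, ∀ w ∈ Icc 0 M.B, M.Achieves s w (μ s w)) ∧
    -- every optimal policy does so for almost all levels, and at the full level,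
    (∀ μ, M.IsOptimal μ →
      (∀ᵐ s ∂(volume.restrict (Icc 0 M.sbar)), ∀ᵐ w ∂M.ν, M.Achieves s w (μ s w)) ∧
      ∀ᵐ w ∂M.ν, M.Achieves M.sbar w (μ M.sbar w)) ∧
    -- and so does, at a given level and shock, every policy that is optimal given these
    (∀ μ, M.IsPolicy μ → ∀ s ∈ Icc 0 M.sbar, ∀ w ∈ Icc 0 M.B,
      (∀ μ', M.IsPolicy μ' → M.jumpCost μ s w ≤ M.jumpCost μ' s w) →
      M.Achieves s w (μ s w)) ∧
    -- delay differential equation of a fixed policy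
    (∀ μ, M.IsPolicy μ → DifferentiableOn ℝ (M.policyCost μ) (Icc 0 M.sbar) →
      (∀ s ∈ Icc 0 M.sbar, Integrable (fun w => M.jumpCost μ s w) M.ν) ∧
      -- for almost all levels,
      (∀ᵐ s ∂(volume.restrict (Icc 0 M.sbar)),
        HasDerivWithinAt (M.policyCost μ)
          ((M.Q + M.θ) / M.r * M.policyCost μ s - M.Q / M.r * ∫ w, M.jumpCost μ s w ∂M.ν)
          (Icc 0 M.sbar) s) ∧
      -- at every level where the expectation in the equation is continuous,
      (∀ s ∈ Icc 0 M.sbar,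
        ContinuousWithinAt (fun x => ∫ w, M.jumpCost μ x w ∂M.ν) (Icc 0 M.sbar) s →
        HasDerivWithinAt (M.policyCost μ)
          ((M.Q + M.θ) / M.r * M.policyCost μ s - M.Q / M.r * ∫ w, M.jumpCost μ s w ∂M.ν)
          (Icc 0 M.sbar) s) ∧
      -- with the boundary condition,
      (ContinuousWithinAt (fun x => ∫ w, M.jumpCost μ x w ∂M.ν) (Icc 0 M.sbar) M.sbar →
        HasDerivWithinAt (M.policyCost μ) 0 (Icc 0 M.sbar) M.sbar) ∧
      -- and this continuity holds wherever the policy itself is continuous in the level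
      (∀ s ∈ Icc 0 M.sbar,
        (∀ᵐ w ∂M.ν, ContinuousWithinAt (fun x => μ x w) (Icc 0 M.sbar) s) →
        ContinuousWithinAt (fun x => ∫ w, M.jumpCost μ x w ∂M.ν) (Icc 0 M.sbar) s)) := by
  have hsb := M.sbar_mem
  refine ⟨⟨fun μ hμ s hs => ⟨hμ.ae_summable_blackoutCost hs, hμ.integrable_tsum_blackoutCost hs⟩,
    M.optPolicy, StorageModel.isPolicy_optPolicy, fun s hs =>
      (StorageModel.policyCost_optPolicy hs).trans (StorageModel.optCost_eq hs).symm⟩,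
    StorageModel.strictAntiOn_value.congr fun s hs => (StorageModel.optCost_eq hs).symm,
    fun hg => (StorageModel.convexOn_value hg).congr fun s hs => (StorageModel.optCost_eq hs).symm,
    fun _ => ⟨fun s hs => ⟨StorageModel.integrable_minCost hs,
      StorageModel.hasDerivWithinAt_optCost hs⟩, ?_⟩,
    ⟨M.optPolicy, StorageModel.isOptimal_optPolicy, fun s hs w hw =>
      StorageModel.achieves_optPolicy hs hw⟩,
    fun μ hμ => ⟨hμ.ae_achieves, hμ.ae_achieves_sbar⟩,
    fun μ hμ s hs w hw h => hμ.achieves_of_forall_jumpCost_le hs hw h,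
    fun μ hμ _ => ⟨fun s hs => hμ.integrable_jumpCost hs, ?_,
      fun s hs hc => hμ.hasDerivWithinAt_policyCost_of_continuous hs hc, fun hc => ?_,
      fun s hs hc => hμ.continuousWithinAt_integral_jumpCost hs hc⟩⟩
  · have h := StorageModel.hasDerivWithinAt_optCost hsb
    rwa [StorageModel.integral_minCost hsb, StorageModel.optCost_eq hsb, M.value_eq,
      StorageModel.deriv_sbar_eq_zero] at h
  · filter_upwards [StorageModel.ae_hasDerivWithinAt_discounted
      (M.measurable_meanJumpCost hμ.measurable) M.abs_meanJumpCost_le,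
      ae_restrict_mem measurableSet_Icc] with s h hs
    exact hμ.hasDerivWithinAt_policyCost hs h
  · have h := hμ.hasDerivWithinAt_policyCost_of_continuous hsb hc
    rwa [hμ.integral_jumpCost hsb, hμ.policyCost_eq_discounted hsb,
      StorageModel.deriv_sbar_eq_zero] at h
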